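/- Let $G$ be a Carnot group of step $m \ge 2$, i.e. a non-abelian Carnot group: $G$ is a simply connected (finite-dimensional, real) Lie group whose Lie algebra $\mathfrak g$ has a direct sum decomposition $$\mathfrak g = V_1 \oplus \cdots \oplus V_m, \qquad V_{k+1} = [V_1, V_k] \ (1 \le k < m), \qquad [V_1, V_m] = 0,$$ with all $V_k \neq 0$ and $m \ge 2$. Let $\langle\cdot,\cdot\rangle$ be any inner product on $V_1$, extended by left translations to the left-invariant distribution $\Delta$ on $G$ generated by $V_1$, and let $d$ be the associated left-invariant Carnot–Carathéodory metric on $G$: $$d(x,y) = \inf \int_a^b \sqrt{\langle \dot\gamma(t), \dot\gamma(t)\rangle}\, dt,$$ the infimum being taken over all absolutely continuous curves $\gamma : [a,b] \to G$ from $x$ to $y$ that are tangent to $\Delta$ almost everywhere. Then $(G,d)$ admits no bi-Lipschitz embedding into any Banach space with the Radon–Nikodym property. That is, if $W$ is a real Banach space such that for every $k$ every Lipschitz map $\mathbb R^k \to W$ is differentiable almost everywhere, then there are no map $f : G \to W$ and constant $L \ge 1$ with $$\tfrac1L\, d(x,y) \le \|f(x) - f(y)\| \le L\, d(x,y) \qquad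 \text{for all } x, y \in G.$$ -/

import Mathlib

open MeasureTheory Set
open scoped Manifold ContDiff ENNReal NNReal

noncomputable section

namespace Carnot

section LieGroups

variable {E : Type*} [NormedAddCommGroup E] [NormedSpace ℝ E]
  {G : Type*} [TopologicalSpace G] [ChartedSpace E G] [Group G]

/-- `V` is a stratification of step `m` of the Lie algebra `𝔤` of the Lie group `G`:
`𝔤 = V₁ ⊕ ⋯ ⊕ V_m` with `V_{k+1} = [V₁, V_k]` for `k ≥ 1`, where `V₁, …, V_m` are nonzero and,
by convention, `V_k = 0` for all other indices `k` (in particular `[V₁, V_m] = V_{m+1} = 0`).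
Here `[V₁, V_k]` is the linear span of all brackets. -/
structure IsStratification (V : ℕ → Submodule ℝ (GroupLieAlgebra 𝓘(ℝ, E) G)) (m : ℕ) :
    Prop where
  ne_bot_iff : ∀ k, V k ≠ ⊥ ↔ 1 ≤ k ∧ k ≤ m
  isInternal : DirectSum.IsInternal V
  bracket : ∀ k, 1 ≤ k → V (k + 1) = Submodule.span ℝ {z | ∃ x ∈ V 1, ∃ y ∈ V k, z = ⁅x, y⁆}

/-- Absolute continuity on `[a, b]` of a curve in a manifold (only the values on `[a, b]` matter):
the curve is continuous, and on every subinterval which it maps into the domain of a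
preferred chart, its expression in that chart is absolutely continuous. -/
def IsACCurve (γ : ℝ → G) (a b : ℝ) : Prop :=
  ContinuousOn γ (Icc a b) ∧
    ∀ (p : G) (c d : ℝ), a ≤ c → c ≤ d → d ≤ b → MapsTo γ (Icc c d) (chartAt E p).source →
      AbsolutelyContinuousOnInterval (fun t => chartAt E p (γ t)) c d

/-- `γ` is a horizontal curve on `[a, b]` for the left-invariant distribution on `G` which is
spanned by the subspace `V₁` of the Lie algebra: it is absolutely continuous and
for almost every `t ∈ [a, b]` its velocity `γ'(t)` lies in the distribution, i.e. it is the value at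
`γ t` of the left-invariant vector field given by an element of `V₁`, which is called `u t`. -/
structure IsHorizontalCurve (V₁ : Submodule ℝ (GroupLieAlgebra 𝓘(ℝ, E) G))
    (γ : ℝ → G) (u : ℝ → V₁) (a b : ℝ) : Prop where
  ac : IsACCurve (E := E) γ a b
  velocity : ∀ᵐ t ∂(volume.restrict (Icc a b)),
    HasMFDerivAt 𝓘(ℝ, ℝ) 𝓘(ℝ, E) γ t
      ((1 : ℝ →L[ℝ] ℝ).smulRight
        (mulInvariantVectorField (u t : GroupLieAlgebra 𝓘(ℝ, E) G) (γ t)))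

/-- The length of the horizontal curve with velocity `u t` (seen in the Lie algebra), for the
left-invariant metric on the distribution which is the inner product `g` at the identity. -/
def horizontalLength {V₁ : Submodule ℝ (GroupLieAlgebra 𝓘(ℝ, E) G)}
    (g : InnerProductSpace.Core ℝ V₁) (u : ℝ → V₁) (a b : ℝ) : ℝ≥0∞ :=
  ∫⁻ t in Icc a b, ENNReal.ofReal (Real.sqrt (g.inner (u t) (u t)))

/-- The left-invariant Carnot–Carathéodory distance on `G` given by the subspace `V₁` of the
Lie algebra and the inner product `g` on `V₁`: the infimum of the lengths of all horizontal curves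
from `x` to `y` (it would be `∞` if there were none). -/
def ccEDist {V₁ : Submodule ℝ (GroupLieAlgebra 𝓘(ℝ, E) G)}
    (g : InnerProductSpace.Core ℝ V₁) (x y : G) : ℝ≥0∞ :=
  sInf {ℓ | ∃ (a b : ℝ) (γ : ℝ → G) (u : ℝ → V₁), a ≤ b ∧ γ a = x ∧ γ b = y ∧
    IsHorizontalCurve V₁ γ u a b ∧ ℓ = horizontalLength g u a b}

end LieGroups

/-- The Radon–Nikodym property of a real Banach space `W`: every Lipschitz map from some `ℝ^k`
to `W` is differentiable almost everywhere. -/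
def HasRadonNikodymProperty (W : Type*) [NormedAddCommGroup W] [NormedSpace ℝ W] : Prop :=
  ∀ (k : ℕ) (f : EuclideanSpace ℝ (Fin k) → W) (K : ℝ≥0), LipschitzWith K f →
    ∀ᵐ x ∂(volume : Measure (EuclideanSpace ℝ (Fin k))), DifferentiableAt ℝ f x

/-- `f : X → W` is bi-Lipschitz with respect to the (extended) distance `d` on `X`. -/
def IsBiLipschitz {X W : Type*} [PseudoEMetricSpace W] (d : X → X → ℝ≥0∞) (f : X → W) : Prop :=
  ∃ L : ℝ≥0, 1 ≤ L ∧ ∀ x y : X,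
    (L : ℝ≥0∞)⁻¹ * d x y ≤ edist (f x) (f y) ∧ edist (f x) (f y) ≤ (L : ℝ≥0∞) * d x y

end Carnot

end

/-!
Suppose that `f : G → W` is bi-Lipschitz. The contradiction comes from comparing `f (p * y t * x t)`
with `f (p * x t * y t)`, where `x` and `y` are the one-parameter subgroups of two horizontal
directions `X`, `Y` with `⁅X, Y⁆ ∉ V₁`; they exist because the step is at least `2`
(`IsStratification.exists_bracket_notMem`). Neither Pansu differentiability nor dilations are used.

*Upper bound.* The curves `t ↦ f (p * x t)` are Lipschitz, uniformly in `p`. By the Radon–Nikodym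
property (for curves only) and Fubini's theorem for a right-invariant measure, for almost every `p`
the curve is differentiable at `0` (`HasRadonNikodymProperty.ae_differentiableAt_mul_curve`). Hence
the difference quotients `t⁻¹ • (f (p * x t) - f p)` converge in `L¹` on compact sets, and an `L¹`
convergent sequence of bounded continuous functions is asymptotically invariant under right
translations by elements tending to `1` (`tendsto_setLIntegral_diffQuot_mul_sub`). This is applied
to `x` with translations by `y t` and to `y` with translations by `x t`; the two mixed second
differences of `f` have the same terms apart from `f (p * y t * x t)` and `f (p * x t * y t)`, so
that `t⁻¹ ‖f (p * y t * x t) - f (p * x t * y t)‖` tends to `0` in `L¹`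
(`tendsto_setLIntegral_commutator`).

*Lower bound.* In the chart at `1` the points `x t * y t` and `y t * x t` differ by
`t² ⁅X, Y⁆ + o(t²)`. Let `Λ` be a linear form which vanishes on `V₁` but not at `⁅X, Y⁆`. The
left-invariant horizontal fields lie in `ker Λ` at `1`, so along a horizontal curve of
length `ℓ` which starts at distance `O(t)` from `1` the function `Λ` changes by at most
`O(ℓ (t + ℓ))` (`exists_normal_estimate`). Therefore the Carnot–Carathéodory distance of the two
points is at least `c t`, and by left translation the same holds for `p * y t * x t` and
`p * x t * y t` (`exists_le_ccEDist_commutator`). This is incompatible with the upper bound.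

*Continuity of `f`.* It is needed for the measure theory, but the Carnot–Carathéodory distance is
not known beforehand to be finite or to induce the topology. Instead, the function
`N h = sup_p ‖f (p * h) - f p‖` is subadditive and tends to `0` along horizontal one-parameter
subgroups. The vectors `Ad h X` with `X ∈ V₁` and `N h` small span the Lie algebra, since
the derivative of `Ad (x t) Y` at `0` is `⁅X, Y⁆`. The products of the
curves `h * x t * h⁻¹` thus cover a neighbourhood of `1`, which gives `N → 0` at `1`
(`IsStratification.tendsto_of_isSmallAlong`).
-/

namespace Carnot

/-! ### Partial derivatives of second order -/

section Calculus

variable {E F H : Type*} [NormedAddCommGroup E] [NormedSpace ℝ E] [NormedAddCommGroup F]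
  [NormedSpace ℝ F] [NormedAddCommGroup H] [NormedSpace ℝ H] {Φ : E × F → H} {a : E} {b : F}

theorem _root_.ContDiffAt.eventually_fderiv_partial_right (h : ContDiffAt ℝ 2 Φ (a, b)) :
    (fun u => fderiv ℝ (fun v => Φ (u, v)) b) =ᶠ[nhds a] fun u =>
      (fderiv ℝ Φ (u, b)).comp (ContinuousLinearMap.inr ℝ E F) := by
  have h1 : Filter.Tendsto (fun u : E => (u, b)) (nhds a) (nhds (a, b)) :=
    (Continuous.prodMk_left b).tendsto a
  filter_upwards [h1.eventually (h.eventually (by simp))] with u hu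
  exact ((hu.differentiableAt (by simp)).hasFDerivAt.comp b
    (hasFDerivAt_prodMk_right u b)).fderiv

theorem _root_.ContDiffAt.fderiv_partial_right (h : ContDiffAt ℝ 2 Φ (a, b)) :
    ContDiffAt ℝ 1 (fun u => fderiv ℝ (fun v => Φ (u, v)) b) a := by
  refine ContDiffAt.congr_of_eventuallyEq ?_ h.eventually_fderiv_partial_right
  have h1 : ContDiffAt ℝ 1 (fderiv ℝ Φ) (a, b) := h.fderiv_right (by norm_num)
  exact (h1.comp (f := fun u : E => (u, b)) a (contDiffAt_id.prodMk contDiffAt_const)).clm_comp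
    contDiffAt_const

theorem _root_.ContDiffAt.hasFDerivAt_partial_right (h : ContDiffAt ℝ 2 Φ (a, b)) :
    HasFDerivAt (fun u => fderiv ℝ (fun v => Φ (u, v)) b)
      ((fderiv ℝ (fderiv ℝ Φ) (a, b)).bilinearComp
        (ContinuousLinearMap.inl ℝ E F) (ContinuousLinearMap.inr ℝ E F)) a := by
  refine HasFDerivAt.congr_of_eventuallyEq ?_ h.eventually_fderiv_partial_right
  have h1 : ContDiffAt ℝ 1 (fderiv ℝ Φ) (a, b) := h.fderiv_right (by norm_num)
  have h3 : HasFDerivAt (fun u => fderiv ℝ Φ (u, b)) _ a :=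
    (h1.differentiableAt (by simp)).hasFDerivAt.comp a (hasFDerivAt_prodMk_left a b)
  have h2 := h3.clm_comp (hasFDerivAt_const (ContinuousLinearMap.inr ℝ E F) a)
  convert! h2 using 1
  ext x y
  simp

end Calculus

/-! ### Multiplication and left-invariant fields in the chart at the identity -/

section Chart

variable {E : Type*} [NormedAddCommGroup E] [NormedSpace ℝ E]
  {G : Type*} [TopologicalSpace G] [ChartedSpace E G] [Group G]

variable (E G) in
/-- The image of the identity under the preferred chart at the identity. -/
noncomputable def idPt : E := extChartAt 𝓘(ℝ, E) (1 : G) 1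

variable (G) in
/-- The multiplication of `G` read in the chart at the identity. Only its values near
`(idPt E G, idPt E G)` are meaningful. -/
noncomputable def chartMul (u v : E) : E :=
  extChartAt 𝓘(ℝ, E) (1 : G)
    ((extChartAt 𝓘(ℝ, E) (1 : G)).symm u * (extChartAt 𝓘(ℝ, E) (1 : G)).symm v)

variable (G) in
/-- The left-invariant frame in the chart at the identity: `leftFrame G u w` is the value at `u` of
the left-invariant vector field with value `w` at the identity. -/
noncomputable def leftFrame (u : E) : E →L[ℝ] E := fderiv ℝ (chartMul G u) (idPt E G)

variable (E G) in
/-- The coordinates of the Lie algebra given by the chart at the identity. The type of the Lie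
algebra unfolds to `E`, and this is the identity map; it keeps the two types apart. -/
noncomputable def lieCoord : GroupLieAlgebra 𝓘(ℝ, E) G ≃ₗ[ℝ] E := LinearEquiv.refl ℝ E

theorem symm_idPt : (extChartAt 𝓘(ℝ, E) (1 : G)).symm (idPt E G) = 1 := by
  simp [idPt]

theorem chartMul_idPt_left {v : E} (hv : v ∈ (extChartAt 𝓘(ℝ, E) (1 : G)).target) :
    chartMul G (idPt E G) v = v := by
  rw [chartMul, symm_idPt, one_mul, PartialEquiv.right_inv _ hv]

theorem chartMul_idPt_right {v : E} (hv : v ∈ (extChartAt 𝓘(ℝ, E) (1 : G)).target) :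
    chartMul G v (idPt E G) = v := by
  rw [chartMul, symm_idPt, mul_one, PartialEquiv.right_inv _ hv]

theorem target_mem_nhds : (extChartAt 𝓘(ℝ, E) (1 : G)).target ∈ nhds (idPt E G) :=
  extChartAt_target_mem_nhds (I := 𝓘(ℝ, E)) (1 : G)

theorem source_mem_nhds : (extChartAt 𝓘(ℝ, E) (1 : G)).source ∈ nhds (1 : G) :=
  extChartAt_source_mem_nhds (I := 𝓘(ℝ, E)) (1 : G)

variable [LieGroup 𝓘(ℝ, E) ∞ G]

theorem contMDiffAt_symm {u : E} (hu : u ∈ (extChartAt 𝓘(ℝ, E) (1 : G)).target) :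
    ContMDiffAt 𝓘(ℝ, E) 𝓘(ℝ, E) ∞ (extChartAt 𝓘(ℝ, E) (1 : G)).symm u := by
  have : IsManifold 𝓘(ℝ, E) ∞ G := ‹LieGroup 𝓘(ℝ, E) ∞ G›.toContMDiffMul.toIsManifold
  exact (contMDiffOn_extChartAt_symm (1 : G)).contMDiffAt
    ((isOpen_extChartAt_target (I := 𝓘(ℝ, E)) (1 : G)).mem_nhds hu)

theorem contMDiffAt_chart {p : G} (hp : p ∈ (extChartAt 𝓘(ℝ, E) (1 : G)).source) :
    ContMDiffAt 𝓘(ℝ, E) 𝓘(ℝ, E) ∞ (extChartAt 𝓘(ℝ, E) (1 : G)) p := by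
  have : IsManifold 𝓘(ℝ, E) ∞ G := ‹LieGroup 𝓘(ℝ, E) ∞ G›.toContMDiffMul.toIsManifold
  exact contMDiffAt_extChartAt' (by simpa using hp)

theorem contMDiffAt_mul_left' (g p : G) : ContMDiffAt 𝓘(ℝ, E) 𝓘(ℝ, E) ∞ (g * ·) p :=
  contMDiffAt_mul_left

theorem contDiffAt_chartMul : ContDiffAt ℝ ∞ (fun z : E × E => chartMul G z.1 z.2)
    (idPt E G, idPt E G) := by
  rw [← contMDiffAt_iff_contDiffAt]
  have h1 : ContMDiffAt 𝓘(ℝ, E × E) 𝓘(ℝ, E) ∞ (fun z : E × E =>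
      (extChartAt 𝓘(ℝ, E) (1 : G)).symm z.1) (idPt E G, idPt E G) :=
    (contMDiffAt_symm (mem_extChartAt_target (I := 𝓘(ℝ, E)) (1 : G))).comp
      (idPt E G, idPt E G) contDiffAt_fst.contMDiffAt
  have h2 : ContMDiffAt 𝓘(ℝ, E × E) 𝓘(ℝ, E) ∞ (fun z : E × E =>
      (extChartAt 𝓘(ℝ, E) (1 : G)).symm z.2) (idPt E G, idPt E G) :=
    (contMDiffAt_symm (mem_extChartAt_target (I := 𝓘(ℝ, E)) (1 : G))).comp
      (idPt E G, idPt E G) contDiffAt_snd.contMDiffAt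
  have h3 := h1.mul h2
  refine ContMDiffAt.comp (g := extChartAt 𝓘(ℝ, E) (1 : G)) (idPt E G, idPt E G) ?_ h3
  simp only [symm_idPt, mul_one]
  exact contMDiffAt_chart (mem_extChartAt_source (I := 𝓘(ℝ, E)) (1 : G))

theorem mfderiv_chart_mulInvariantVectorField (X : GroupLieAlgebra 𝓘(ℝ, E) G) {g : G}
    (hg : g ∈ (extChartAt 𝓘(ℝ, E) (1 : G)).source) :
    mfderiv 𝓘(ℝ, E) 𝓘(ℝ, E) (extChartAt 𝓘(ℝ, E) (1 : G)) g (mulInvariantVectorField X g) =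
      leftFrame G (extChartAt 𝓘(ℝ, E) (1 : G) g) (lieCoord E G X) := by
  have hc : HasMFDerivAt 𝓘(ℝ, E) 𝓘(ℝ, E) (extChartAt 𝓘(ℝ, E) (1 : G)) (g * 1)
      (mfderiv 𝓘(ℝ, E) 𝓘(ℝ, E) (extChartAt 𝓘(ℝ, E) (1 : G)) (g * 1)) := by
    apply MDifferentiableAt.hasMFDerivAt
    rw [mul_one]
    exact (contMDiffAt_chart hg).mdifferentiableAt (by simp)
  have hm : MDifferentiableAt 𝓘(ℝ, E) 𝓘(ℝ, E) (fun x : G => g * x) 1 :=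
    (contMDiffAt_mul_left' g 1).mdifferentiableAt (by simp)
  have h1 := hc.comp 1 hm.hasMFDerivAt
  set A : E →L[ℝ] E := (mfderiv 𝓘(ℝ, E) 𝓘(ℝ, E) (extChartAt 𝓘(ℝ, E) (1 : G)) (g * 1)).comp
    (mfderiv 𝓘(ℝ, E) 𝓘(ℝ, E) (fun x : G => g * x) 1)
  have h2 : HasFDerivWithinAt (fun v => extChartAt 𝓘(ℝ, E) (1 : G)
      (g * (extChartAt 𝓘(ℝ, E) (1 : G)).symm v)) A (range 𝓘(ℝ, E)) (idPt E G) := h1.2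
  rw [ModelWithCorners.range_eq_univ, hasFDerivWithinAt_univ] at h2
  have h3 : leftFrame G (extChartAt 𝓘(ℝ, E) (1 : G) g) = A := by
    rw [← h2.fderiv, leftFrame]
    congr 1
    ext v
    rw [chartMul, PartialEquiv.left_inv _ hg]
  have h4 : (leftFrame G (extChartAt 𝓘(ℝ, E) (1 : G) g) (lieCoord E G X) : E) =
      mfderiv 𝓘(ℝ, E) 𝓘(ℝ, E) (extChartAt 𝓘(ℝ, E) (1 : G)) (g * 1)
        (mfderiv 𝓘(ℝ, E) 𝓘(ℝ, E) (fun x : G => g * x) 1 X) := by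
    rw [h3]; rfl
  refine Eq.trans ?_ h4.symm
  rw [mulInvariantVectorField]
  have key : ∀ p : G, p = g → ∀ Z : E,
    (mfderiv 𝓘(ℝ, E) 𝓘(ℝ, E) (extChartAt 𝓘(ℝ, E) (1 : G)) g : E → E) Z =
      (mfderiv 𝓘(ℝ, E) 𝓘(ℝ, E) (extChartAt 𝓘(ℝ, E) (1 : G)) p : E → E) Z := by
    rintro p rfl Z; rfl
  exact key _ (mul_one g) _

theorem hasDerivAt_chart_comp {γ : ℝ → G} {t : ℝ} {X : GroupLieAlgebra 𝓘(ℝ, E) G}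
    (hγ : HasMFDerivAt 𝓘(ℝ, ℝ) 𝓘(ℝ, E) γ t
      ((1 : ℝ →L[ℝ] ℝ).smulRight (mulInvariantVectorField X (γ t))))
    (ht : γ t ∈ (extChartAt 𝓘(ℝ, E) (1 : G)).source) :
    HasDerivAt (fun s => extChartAt 𝓘(ℝ, E) (1 : G) (γ s))
      (leftFrame G (extChartAt 𝓘(ℝ, E) (1 : G) (γ t)) (lieCoord E G X)) t := by
  have hc := ((contMDiffAt_chart ht).mdifferentiableAt (by simp)).hasMFDerivAt
  have h1 := hc.comp t hγ
  set A : ℝ →L[ℝ] E := (mfderiv 𝓘(ℝ, E) 𝓘(ℝ, E) (extChartAt 𝓘(ℝ, E) (1 : G)) (γ t)).comp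
    ((1 : ℝ →L[ℝ] ℝ).smulRight (mulInvariantVectorField X (γ t)))
  have h2 : HasFDerivAt (fun s => extChartAt 𝓘(ℝ, E) (1 : G) (γ s)) A t := h1.hasFDerivAt
  convert! h2.hasDerivAt using 1
  rw [← mfderiv_chart_mulInvariantVectorField X ht]
  exact (congrArg _ (one_smul ℝ (mulInvariantVectorField X (γ t)))).symm

theorem hasMFDerivAt_mul_left {γ : ℝ → G} {t : ℝ} {X : GroupLieAlgebra 𝓘(ℝ, E) G} (g : G)
    (hγ : HasMFDerivAt 𝓘(ℝ, ℝ) 𝓘(ℝ, E) γ t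
      ((1 : ℝ →L[ℝ] ℝ).smulRight (mulInvariantVectorField X (γ t)))) :
    HasMFDerivAt 𝓘(ℝ, ℝ) 𝓘(ℝ, E) (fun s => g * γ s) t
      ((1 : ℝ →L[ℝ] ℝ).smulRight (mulInvariantVectorField X (g * γ t))) := by
  have hm (p q : G) : MDifferentiableAt 𝓘(ℝ, E) 𝓘(ℝ, E) (fun x : G => p * x) q :=
    (contMDiffAt_mul_left' p q).mdifferentiableAt (by simp)
  have h1 := (hm g (γ t)).hasMFDerivAt.comp t hγ
  have h2 : mfderiv 𝓘(ℝ, E) 𝓘(ℝ, E) (fun x => g * γ t * x) 1 =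
      (mfderiv 𝓘(ℝ, E) 𝓘(ℝ, E) (fun x => g * x) (γ t * 1)).comp
        (mfderiv 𝓘(ℝ, E) 𝓘(ℝ, E) (fun x => γ t * x) 1) := by
    rw [← mfderiv_comp (I' := 𝓘(ℝ, E)) (1 : G) (hm _ _) (hm _ _)]
    congr 1
    ext x
    simp [mul_assoc]
  have h3 : (mulInvariantVectorField X (g * γ t) : E) =
      mfderiv 𝓘(ℝ, E) 𝓘(ℝ, E) (fun x => g * x) (γ t) (mulInvariantVectorField X (γ t)) := by
    have key : ∀ p q : G, p = q → ∀ Z : E,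
        (mfderiv 𝓘(ℝ, E) 𝓘(ℝ, E) (fun x : G => g * x) p : E → E) Z =
          (mfderiv 𝓘(ℝ, E) 𝓘(ℝ, E) (fun x : G => g * x) q : E → E) Z := by
      rintro p q rfl Z; rfl
    exact (congrArg (fun T : E →L[ℝ] E => T (lieCoord E G X)) h2).trans (key _ _ (mul_one (γ t)) _)
  set A : ℝ →L[ℝ] E := (mfderiv 𝓘(ℝ, E) 𝓘(ℝ, E) (fun x : G => g * x) (γ t)).comp
    ((1 : ℝ →L[ℝ] ℝ).smulRight (mulInvariantVectorField X (γ t)))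
  set B : ℝ →L[ℝ] E := (1 : ℝ →L[ℝ] ℝ).smulRight (mulInvariantVectorField X (g * γ t))
  have h5 : A = B := by
    refine ContinuousLinearMap.ext_ring ?_
    exact ((congrArg (fun Z : E => (1 : ℝ) • Z) h3).trans
      (map_smul (mfderiv 𝓘(ℝ, E) 𝓘(ℝ, E) (fun x : G => g * x) (γ t)) (1 : ℝ) _).symm).symm
  exact h1.congr_mfderiv h5

/-- The Lie bracket of the Lie algebra, computed by vector fields on `E`. -/
theorem bracket_eq (X Y : GroupLieAlgebra 𝓘(ℝ, E) G) :
    lieCoord E G ⁅X, Y⁆ = VectorField.lieBracket ℝ (fun u => leftFrame G u (lieCoord E G X))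
      (fun u => leftFrame G u (lieCoord E G Y)) (idPt E G) := by
  have : IsManifold 𝓘(ℝ, E) ∞ G := ‹LieGroup 𝓘(ℝ, E) ∞ G›.toContMDiffMul.toIsManifold
  have : IsManifold 𝓘(ℝ, E) 1 G := IsManifold.of_le (n := ∞) (by simp)
  have key : ∀ Z : GroupLieAlgebra 𝓘(ℝ, E) G,
      (VectorField.mpullbackWithin 𝓘(ℝ, E) 𝓘(ℝ, E) (extChartAt 𝓘(ℝ, E) (1 : G)).symm
        (mulInvariantVectorField Z) (range 𝓘(ℝ, E)) : E → E) =ᶠ[nhds (idPt E G)]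
        fun u => leftFrame G u (lieCoord E G Z) := by
    intro Z
    filter_upwards [target_mem_nhds (E := E) (G := G)] with u hu
    have h1 := isInvertible_mfderivWithin_extChartAt_symm hu
    rw [VectorField.mpullbackWithin_apply]
    have h2 := mfderiv_chart_mulInvariantVectorField Z (PartialEquiv.map_target _ hu)
    rw [PartialEquiv.right_inv _ hu] at h2
    rw [← h2]
    have h3 := ContinuousLinearMap.inverse_eq
      (mfderivWithin_extChartAt_symm_comp_mfderiv_extChartAt hu)
      (mfderiv_extChartAt_comp_mfderivWithin_extChartAt_symm hu)
    exact congrArg (fun T => T (mulInvariantVectorField Z _)) h3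
  rw [GroupLieAlgebra.bracket_def]
  rw [← VectorField.mlieBracketWithin_univ, VectorField.mlieBracketWithin_apply]
  have h1 : (mfderiv 𝓘(ℝ, E) 𝓘(ℝ, E) (extChartAt 𝓘(ℝ, E) (1 : G)) 1).inverse
    = ContinuousLinearMap.id ℝ E := by
    rw [mfderiv_extChartAt_self]
    exact ContinuousLinearMap.inverse_id
  refine (congrArg (fun T : E →L[ℝ] E => T _) h1).trans ?_
  change VectorField.lieBracketWithin ℝ _ _ ((extChartAt 𝓘(ℝ, E) (1 : G)).symm ⁻¹' univ ∩
    range 𝓘(ℝ, E)) (idPt E G) = _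
  rw [ModelWithCorners.range_eq_univ, preimage_univ, univ_inter]
  refine (congrFun VectorField.lieBracketWithin_univ _).trans ?_
  have k1 := key X
  have k2 := key Y
  rw [ModelWithCorners.range_eq_univ] at k1 k2
  exact k1.lieBracket_vectorField_eq k2

variable (E G) in
/-- The mixed second derivative of the multiplication at the identity. -/
noncomputable def mulMixed : E →L[ℝ] E →L[ℝ] E :=
  ((fderiv ℝ (fderiv ℝ (fun z : E × E => chartMul G z.1 z.2)) (idPt E G, idPt E G)).bilinearComp
    (ContinuousLinearMap.inl ℝ E E) (ContinuousLinearMap.inr ℝ E E))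

theorem contDiffAt_chartMul_two : ContDiffAt ℝ 2 (fun z : E × E => chartMul G z.1 z.2)
    (idPt E G, idPt E G) :=
  contDiffAt_chartMul.of_le (by norm_cast)

theorem contDiffAt_leftFrame : ContDiffAt ℝ 1 (leftFrame (E := E) G) (idPt E G) :=
  contDiffAt_chartMul_two.fderiv_partial_right

theorem fderiv_leftFrame_apply (a b : E) :
    fderiv ℝ (fun u => leftFrame G u b) (idPt E G) a = mulMixed E G a b := by
  have h := contDiffAt_chartMul_two (E := E) (G := G)
  have h2 : HasFDerivAt (fun u => leftFrame G u) (mulMixed E G) (idPt E G) :=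
    h.hasFDerivAt_partial_right
  rw [(h2.clm_apply (hasFDerivAt_const b _)).fderiv]
  simp

omit [LieGroup 𝓘(ℝ, E) ∞ G] in
theorem leftFrame_idPt : leftFrame G (idPt E G) = ContinuousLinearMap.id ℝ E := by
  rw [leftFrame, ← fderiv_id (𝕜 := ℝ) (x := idPt E G)]
  refine Filter.EventuallyEq.fderiv_eq ?_
  filter_upwards [target_mem_nhds (E := E) (G := G)] with v hv
  exact chartMul_idPt_left hv

theorem bracket_eq_mulMixed (X Y : GroupLieAlgebra 𝓘(ℝ, E) G) :
    lieCoord E G ⁅X, Y⁆ = mulMixed E G (lieCoord E G X) (lieCoord E G Y) -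
      mulMixed E G (lieCoord E G Y) (lieCoord E G X) := by
  rw [bracket_eq, VectorField.lieBracket_eq]
  simp only [leftFrame_idPt, ContinuousLinearMap.id_apply, fderiv_leftFrame_apply]

end Chart

/-! ### One-parameter subgroups -/

section OneParam

variable {E : Type*} [NormedAddCommGroup E] [NormedSpace ℝ E] [CompleteSpace E]
  {G : Type*} [TopologicalSpace G] [ChartedSpace E G] [Group G] [LieGroup 𝓘(ℝ, E) ∞ G]

omit [CompleteSpace E] in
theorem isManifold_of_lieGroup {n : WithTop ℕ∞} (hn : n ≤ (⊤ : ℕ∞)) : IsManifold 𝓘(ℝ, E) n G :=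
  have : IsManifold 𝓘(ℝ, E) ∞ G := ‹LieGroup 𝓘(ℝ, E) ∞ G›.toContMDiffMul.toIsManifold
  IsManifold.of_le hn

omit [CompleteSpace E] in
theorem contMDiff_one_mulInvariantVectorField (X : GroupLieAlgebra 𝓘(ℝ, E) G) :
    ContMDiff 𝓘(ℝ, E) (𝓘(ℝ, E).tangent) 1
      (fun g : G => (⟨g, mulInvariantVectorField X g⟩ : TangentBundle 𝓘(ℝ, E) G)) := by
  have h3 : LieGroup 𝓘(ℝ, E) (minSmoothness ℝ 3) G :=
    LieGroup.of_le (n := (⊤ : ℕ∞)) (by simp only [minSmoothness_of_isRCLikeNormedField]; norm_cast)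
  exact (contMDiff_mulInvariantVectorField X).of_le (by simp)

/-- Left translation carries a local integral curve at `1` to every point, with the same interval
of existence, so left-invariant fields are complete. -/
theorem exists_isMIntegralCurve_mulInvariantVectorField [T2Space G]
    (X : GroupLieAlgebra 𝓘(ℝ, E) G) :
    ∃ x : ℝ → G, x 0 = 1 ∧ IsMIntegralCurve x (mulInvariantVectorField X) := by
  have : IsManifold 𝓘(ℝ, E) 1 G := isManifold_of_lieGroup (by norm_cast)
  have hv := contMDiff_one_mulInvariantVectorField X
  obtain ⟨γ, h0, hγ⟩ := exists_isMIntegralCurveAt_of_contMDiffAt_boundaryless (t₀ := 0)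
    (hv.contMDiffAt (x := (1 : G)))
  rw [isMIntegralCurveAt_iff'] at hγ
  obtain ⟨ε, hε, hγ⟩ := hγ
  refine exists_isMIntegralCurve_of_isMIntegralCurveOn hv hε (fun p => ?_) 1
  refine ⟨fun t => p * γ t, by simp [h0], ?_⟩
  have h1 : Metric.ball (0 : ℝ) ε = Ioo (-ε) ε := by simp [Real.ball_eq_Ioo]
  rw [← h1]
  intro t ht
  exact (hasMFDerivAt_mul_left p
    ((hγ t ht).hasMFDerivAt (Metric.isOpen_ball.mem_nhds ht))).hasMFDerivWithinAt

/-- `x` is the one-parameter subgroup of `G` with initial velocity `X`. It is then an integral curve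
of the left-invariant vector field `X`; the `C¹` regularity is part of the definition. -/
structure IsOneParameterSubgroup (X : GroupLieAlgebra 𝓘(ℝ, E) G) (x : ℝ → G) : Prop where
  zero : x 0 = 1
  add : ∀ s t, x (s + t) = x s * x t
  hasMFDerivAt : ∀ t, HasMFDerivAt 𝓘(ℝ, ℝ) 𝓘(ℝ, E) x t
    ((1 : ℝ →L[ℝ] ℝ).smulRight (mulInvariantVectorField X (x t)))
  contMDiff : ContMDiff 𝓘(ℝ, ℝ) 𝓘(ℝ, E) 1 x

theorem exists_isOneParameterSubgroup [T2Space G] (X : GroupLieAlgebra 𝓘(ℝ, E) G) :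
    ∃ x : ℝ → G, IsOneParameterSubgroup X x := by
  have : IsManifold 𝓘(ℝ, E) 1 G := isManifold_of_lieGroup (by norm_cast)
  have hv := contMDiff_one_mulInvariantVectorField X
  obtain ⟨x, h0, hx⟩ := exists_isMIntegralCurve_mulInvariantVectorField X
  have hadd : ∀ s t, x (s + t) = x s * x t := by
    intro s t
    have h1 : IsMIntegralCurve (fun t => x s * x t) (mulInvariantVectorField X) :=
      fun t => hasMFDerivAt_mul_left (x s) (hx t)
    have h2 := isMIntegralCurve_Ioo_eq_of_contMDiff_boundaryless (t₀ := 0) hv h1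
      (hx.comp_add s) (by simp [h0])
    have h3 := congrFun h2 t
    simp only [Function.comp_apply] at h3
    rw [h3, add_comm]
  have hcont : Continuous x := continuous_iff_continuousAt.2 fun t => (hx t).1
  refine ⟨x, h0, hadd, hx, ?_⟩
  -- in the chart `x` solves an ordinary differential equation with a `C¹` right-hand side
  have hloc : ContMDiffAt 𝓘(ℝ, ℝ) 𝓘(ℝ, E) 1 x 0 := by
    set α : ℝ → E := fun t => extChartAt 𝓘(ℝ, E) (1 : G) (x t) with hα
    have hx0 : Filter.Tendsto x (nhds 0) (nhds 1) := h0 ▸ hcont.tendsto 0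
    have hα0 : α 0 = idPt E G := by simp [hα, h0, idPt]
    have hsrc : ∀ᶠ t in nhds 0, x t ∈ (extChartAt 𝓘(ℝ, E) (1 : G)).source :=
      hx0.eventually source_mem_nhds
    have hd : ∀ᶠ t in nhds 0, HasDerivAt α (leftFrame G (α t) (lieCoord E G X)) t :=
      hsrc.mono fun t ht => hasDerivAt_chart_comp (hx t) ht
    have hαc : Filter.Tendsto α (nhds 0) (nhds (idPt E G)) :=
      hα0 ▸ hd.self_of_nhds.continuousAt.tendsto
    have hΘ : ∀ᶠ u in nhds (idPt E G), ContinuousAt (leftFrame (E := E) G) u :=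
      (contDiffAt_leftFrame.eventually (by simp)).mono fun u hu => hu.continuousAt
    have hα1 : ContDiffAt ℝ 1 α 0 := by
      obtain ⟨u, hu, hu'⟩ := (hd.and (hαc.eventually hΘ)).exists_mem
      refine contDiffAt_one_iff.2 ⟨fun t => (1 : ℝ →L[ℝ] ℝ).smulRight
        (leftFrame G (α t) (lieCoord E G X)), u, hu, fun t ht => ?_, fun t ht =>
        (hu' t ht).1.hasFDerivAt⟩
      have h1 : ContinuousAt (fun t => leftFrame G (α t)) t :=
        ContinuousAt.comp (g := leftFrame G) (hu' t ht).2 (hu' t ht).1.continuousAt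
      have h2 : ContinuousAt (fun t => leftFrame G (α t) (lieCoord E G X)) t :=
        h1.clm_apply continuousAt_const
      exact (ContinuousLinearMap.smulRightL ℝ ℝ E 1).continuous.continuousAt.comp h2
        |>.continuousWithinAt
    have h1 : ContMDiffAt 𝓘(ℝ, ℝ) 𝓘(ℝ, E) 1
        (fun t => (extChartAt 𝓘(ℝ, E) (1 : G)).symm (α t)) 0 := by
      refine ContMDiffAt.comp (g := (extChartAt 𝓘(ℝ, E) (1 : G)).symm) 0 ?_ hα1.contMDiffAt
      rw [hα0]
      exact (contMDiffAt_symm (mem_extChartAt_target (I := 𝓘(ℝ, E)) (1 : G))).of_le (by simp)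
    refine h1.congr_of_eventuallyEq ?_
    filter_upwards [hsrc] with t ht
    exact (PartialEquiv.left_inv _ ht).symm
  -- translation moves the regularity at `0` to every time
  intro t
  have h2 : x = fun s => x t * x (s - t) := by
    ext s; rw [← hadd]; congr 1; ring
  rw [h2]
  refine ContMDiffAt.comp (g := fun p : G => x t * p) t
    ((contMDiffAt_mul_left' (x t) _).of_le (by simp)) ?_
  refine ContMDiffAt.comp_of_eq (g := x) (y := (0 : ℝ)) hloc ?_ (sub_self t)
  exact (contDiff_id.sub contDiff_const).contMDiff.contMDiffAt

end OneParam

section UpperBound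

variable {E : Type*} [NormedAddCommGroup E] [NormedSpace ℝ E]
  {G : Type*} [TopologicalSpace G] [ChartedSpace E G] [Group G] [LieGroup 𝓘(ℝ, E) ∞ G]

theorem isACCurve_of_contMDiff {γ : ℝ → G} (hγ : ContMDiff 𝓘(ℝ, ℝ) 𝓘(ℝ, E) 1 γ) (a b : ℝ) :
    IsACCurve (E := E) γ a b := by
  have : IsManifold 𝓘(ℝ, E) 1 G := isManifold_of_lieGroup (by norm_cast)
  refine ⟨hγ.continuous.continuousOn, fun p c d _ hcd _ hmaps => ?_⟩
  have h1 : ContDiffOn ℝ 1 (fun t => chartAt E p (γ t)) (Icc c d) := by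
    rw [← contMDiffOn_iff_contDiffOn]
    have h2 : ContMDiffOn 𝓘(ℝ, E) 𝓘(ℝ, E) 1 (chartAt E p) (chartAt E p).source :=
      contMDiffOn_chart
    exact h2.comp hγ.contMDiffOn hmaps
  obtain ⟨K, hK⟩ := h1.exists_lipschitzOnWith (by simp) (convex_Icc c d) isCompact_Icc
  rw [← uIcc_of_le hcd] at hK
  exact hK.absolutelyContinuousOnInterval

theorem ccEDist_mul_oneParam_le {V₁ : Submodule ℝ (GroupLieAlgebra 𝓘(ℝ, E) G)}
    (g : InnerProductSpace.Core ℝ V₁) (X : V₁) {x : ℝ → G}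
    (hx : IsOneParameterSubgroup (X : GroupLieAlgebra 𝓘(ℝ, E) G) x) (p : G) {a b : ℝ} (hab : a ≤ b) :
    ccEDist g (p * x a) (p * x b) ≤
      ENNReal.ofReal (√(g.inner X X)) * ENNReal.ofReal (b - a) := by
  refine sInf_le ⟨a, b, fun t => p * x t, fun _ => X, hab, rfl, rfl, ⟨?_, ?_⟩, ?_⟩
  · refine isACCurve_of_contMDiff (fun t => ?_) a b
    exact ContMDiffAt.comp (g := fun q : G => p * q) t
      ((contMDiffAt_mul_left' p _).of_le (by norm_cast)) (hx.contMDiff t)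
  · exact Filter.Eventually.of_forall fun t => hasMFDerivAt_mul_left p (hx.hasMFDerivAt t)
  · simp [horizontalLength]

end UpperBound

/-! ### Absolutely continuous curves -/

section AC

theorem _root_.AbsolutelyContinuousOnInterval.of_dist_le {X Y : Type*}
    [PseudoMetricSpace X] [PseudoMetricSpace Y] {K : ℝ} {f : ℝ → Y} {h : ℝ → X} {a b : ℝ}
    (hh : AbsolutelyContinuousOnInterval h a b)
    (hf : ∀ s ∈ uIcc a b, ∀ t ∈ uIcc a b, dist (f s) (f t) ≤ K * dist (h s) (h t)) :
    AbsolutelyContinuousOnInterval f a b := by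
  have h1 := Filter.Tendsto.const_mul K hh
  rw [mul_zero] at h1
  refine squeeze_zero' (Filter.Eventually.of_forall fun I =>
    Finset.sum_nonneg fun i _ => dist_nonneg) ?_ h1
  refine Filter.mem_inf_of_right fun I hI => ?_
  simp only [mem_ofPred_eq, Finset.mul_sum]
  exact Finset.sum_le_sum fun i hi => hf _ (hI.1 i hi).1 _ (hI.1 i hi).2

/-- The fundamental theorem of calculus is available for real functions, so the curve is tested
with a linear functional which norms `h b - h a`. -/
theorem edist_le_lintegral_of_absolutelyContinuous {F : Type*} [NormedAddCommGroup F]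
    [NormedSpace ℝ F] {h h' : ℝ → F} {k : ℝ → ℝ≥0∞} {a b : ℝ} (hab : a ≤ b)
    (hac : AbsolutelyContinuousOnInterval h a b)
    (hd : ∀ᵐ t ∂(volume.restrict (Icc a b)), HasDerivAt h (h' t) t)
    (hk : ∀ᵐ t ∂(volume.restrict (Icc a b)), ‖h' t‖ₑ ≤ k t) :
    edist (h a) (h b) ≤ ∫⁻ t in Icc a b, k t := by
  obtain ⟨ψ, hψ, hψ'⟩ := exists_dual_vector'' ℝ (h b - h a)
  have hac' : AbsolutelyContinuousOnInterval (fun t => ψ (h t)) a b :=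
    hac.of_dist_le fun s _ t _ => ψ.lipschitz.dist_le_mul _ _
  have h1 := hac'.integral_deriv_eq_sub
  rw [← map_sub, hψ', intervalIntegral.integral_of_le hab, ← integral_Icc_eq_integral_Ioc] at h1
  have h2 : edist (h a) (h b) = ‖∫ t in Icc a b, deriv (fun t => ψ (h t)) t‖ₑ := by
    rw [h1, edist_comm, edist_eq_enorm_sub]
    simp
  rw [h2]
  refine (enorm_integral_le_lintegral_enorm _).trans (lintegral_mono_ae ?_)
  filter_upwards [hd, hk] with t ht hkt
  have h3 : HasDerivAt (fun t => ψ (h t)) (ψ (h' t)) t := ψ.hasFDerivAt.comp_hasDerivAt t ht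
  rw [h3.deriv]
  refine le_trans ?_ hkt
  rw [← ofReal_norm, ← ofReal_norm]
  refine ENNReal.ofReal_le_ofReal ((ψ.le_opNorm _).trans ?_)
  exact mul_le_of_le_one_left (norm_nonneg _) hψ

/-- A linear map on a finite-dimensional space is bounded for the norm of any inner product. -/
theorem exists_norm_le_sqrt_inner {V E : Type*} [AddCommGroup V] [Module ℝ V]
    [FiniteDimensional ℝ V] [NormedAddCommGroup E] [NormedSpace ℝ E]
    (g : InnerProductSpace.Core ℝ V) (L : V →ₗ[ℝ] E) :
    ∃ C : ℝ≥0, ∀ v, ‖L v‖ₑ ≤ C * ENNReal.ofReal √(g.inner v v) := by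
  let _ : NormedAddCommGroup V := g.toNormedAddCommGroup
  let _ : InnerProductSpace ℝ V := InnerProductSpace.ofCore g.toCore
  refine ⟨‖LinearMap.toContinuousLinearMap L‖₊, fun v => ?_⟩
  have h1 := (LinearMap.toContinuousLinearMap L).le_opNorm v
  have h2 : ‖v‖ = √(g.inner v v) := rfl
  rw [← h2, ofReal_norm]
  exact (LinearMap.toContinuousLinearMap L).le_opENorm v

end AC

/-! ### Commutators of curves to second order -/

section MixedDifference

variable {E F H : Type*} [NormedAddCommGroup E] [NormedSpace ℝ E] [NormedAddCommGroup F]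
  [NormedSpace ℝ F] [NormedAddCommGroup H] [NormedSpace ℝ H] {Φ : E × F → H} {a : E} {b : F}

/-- The mixed second difference of a `C²` function is its mixed second derivative up to an error
which is small relative to the product of the two increments. -/
theorem _root_.ContDiffAt.isLittleO_mixed_difference (h : ContDiffAt ℝ 2 Φ (a, b)) :
    (fun z : E × F => Φ z - Φ (z.1, b) - (Φ (a, z.2) - Φ (a, b)) -
      fderiv ℝ (fderiv ℝ Φ) (a, b) (z.1 - a, 0) (0, z.2 - b)) =o[nhds (a, b)]
      fun z => ‖z.1 - a‖ * ‖z.2 - b‖ := by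
  rw [Asymptotics.isLittleO_iff]
  intro ε hε
  set D := fderiv ℝ (fderiv ℝ Φ) (a, b)
  have h1 : HasStrictFDerivAt (fderiv ℝ Φ) D (a, b) :=
    (h.fderiv_right (m := 1) (by norm_num)).hasStrictFDerivAt (by simp)
  have h2 := h1.isLittleO.bound hε
  have hdiff : ∀ᶠ z in nhds (a, b), DifferentiableAt ℝ Φ z :=
    (h.eventually (by simp)).mono fun z hz => hz.differentiableAt (by simp)
  obtain ⟨δ₁, hδ₁, hb₁⟩ := Metric.eventually_nhds_iff_ball.1 h2
  obtain ⟨δ₂, hδ₂, hb₂⟩ := Metric.eventually_nhds_iff_ball.1 hdiff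
  filter_upwards [Metric.ball_mem_nhds (a, b) (lt_min hδ₁ hδ₂)] with z hz
  obtain ⟨u, v⟩ := z
  rw [Metric.mem_ball, Prod.dist_eq, max_lt_iff, lt_min_iff, lt_min_iff] at hz
  obtain ⟨⟨hu₁, hu₂⟩, hv₁, hv₂⟩ := hz
  -- the error term as a function of the second variable; it is estimated by the mean value theorem
  set r : F → H := fun w => Φ (u, w) - Φ (a, w) - D (u - a, 0) (0, w - b) with hr
  have hw : ∀ w ∈ Metric.closedBall b (dist v b), HasFDerivWithinAt r
      ((fderiv ℝ Φ (u, w) - fderiv ℝ Φ (a, w) - D (u - a, 0)).comp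
        (ContinuousLinearMap.inr ℝ E F)) (Metric.closedBall b (dist v b)) w := by
    intro w hw
    rw [Metric.mem_closedBall] at hw
    have hΦ : ∀ c, dist c a < δ₂ → HasFDerivAt (fun w => Φ (c, w))
        ((fderiv ℝ Φ (c, w)).comp (ContinuousLinearMap.inr ℝ E F)) w := by
      intro c hc
      refine (hb₂ (c, w) ?_).hasFDerivAt.comp w (hasFDerivAt_prodMk_right c w)
      rw [Metric.mem_ball, Prod.dist_eq, max_lt_iff]
      exact ⟨hc, hw.trans_lt hv₂⟩
    have hD : HasFDerivAt (fun w => D (u - a, 0) (0, w - b))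
        ((D (u - a, 0)).comp (ContinuousLinearMap.inr ℝ E F)) w := by
      refine (D (u - a, 0)).hasFDerivAt.comp w ?_
      have h3 := (ContinuousLinearMap.inr ℝ E F).hasFDerivAt.comp w
        ((hasFDerivAt_id w).sub_const b)
      exact h3
    exact (((hΦ u hu₂).sub (hΦ a (by simpa using hδ₂))).sub hD).hasFDerivWithinAt
  have hbound : ∀ w ∈ Metric.closedBall b (dist v b),
      ‖(fderiv ℝ Φ (u, w) - fderiv ℝ Φ (a, w) - D (u - a, 0)).comp
        (ContinuousLinearMap.inr ℝ E F)‖ ≤ ε * ‖u - a‖ := by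
    intro w hw
    rw [Metric.mem_closedBall] at hw
    have h4 := hb₁ ((u, w), (a, w)) (by
      simp only [Metric.mem_ball, Prod.dist_eq, max_lt_iff, dist_self]
      exact ⟨⟨hu₁, hw.trans_lt hv₁⟩, hδ₁, hw.trans_lt hv₁⟩)
    simp only [Prod.mk_sub_mk, sub_self, Prod.norm_mk, norm_zero, norm_nonneg, sup_of_le_left]
      at h4
    refine ContinuousLinearMap.opNorm_le_bound _ (by positivity) fun y => ?_
    refine ((fderiv ℝ Φ (u, w) - fderiv ℝ Φ (a, w) - D (u - a, 0)).le_opNorm _).trans ?_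
    gcongr
    simp
  have h5 := (convex_closedBall b (dist v b)).norm_image_sub_le_of_norm_hasFDerivWithin_le hw
    hbound (Metric.mem_closedBall_self dist_nonneg) (Metric.mem_closedBall.2 le_rfl)
  have h6 : r v - r b = Φ (u, v) - Φ (u, b) - (Φ (a, v) - Φ (a, b)) - D (u - a, 0) (0, v - b) := by
    simp only [hr, sub_self, Prod.mk_zero_zero, map_zero]
    abel
  rw [h6] at h5
  simpa [mul_assoc] using h5

end MixedDifference

section Commutator

variable {E : Type*} [NormedAddCommGroup E] [NormedSpace ℝ E]
  {G : Type*} [TopologicalSpace G] [ChartedSpace E G] [Group G] [LieGroup 𝓘(ℝ, E) ∞ G]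

variable (E G) in
theorem chartMul_sub_isLittleO :
    (fun z : E × E => chartMul G z.1 z.2 - (z.1 + z.2 - idPt E G) -
      mulMixed E G (z.1 - idPt E G) (z.2 - idPt E G)) =o[nhds (idPt E G, idPt E G)]
      fun z => ‖z.1 - idPt E G‖ * ‖z.2 - idPt E G‖ := by
  refine (contDiffAt_chartMul_two (E := E) (G := G)).isLittleO_mixed_difference.congr' ?_ .rfl
  have h1 : ∀ᶠ z : E × E in nhds (idPt E G, idPt E G),
      z.1 ∈ (extChartAt 𝓘(ℝ, E) (1 : G)).target ∧ z.2 ∈ (extChartAt 𝓘(ℝ, E) (1 : G)).target := by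
    rw [nhds_prod_eq]
    exact (Filter.tendsto_fst.eventually target_mem_nhds).and
      (Filter.tendsto_snd.eventually target_mem_nhds)
  filter_upwards [h1] with z hz
  simp only [chartMul_idPt_left hz.2, chartMul_idPt_right hz.1,
    chartMul_idPt_left (mem_of_mem_nhds target_mem_nhds), mulMixed,
    ContinuousLinearMap.bilinearComp_apply, ContinuousLinearMap.inl_apply,
    ContinuousLinearMap.inr_apply]
  abel

/-- For curves through the identity the multiplication minus the sum is the mixed derivative to
second order; antisymmetrization gives the commutator. Only first derivatives of the curves are
needed because the terms linear in `u` and `v` cancel. -/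
theorem tendsto_chartMul_commutator {u v : ℝ → E} {X Y : E} (hu0 : u 0 = idPt E G)
    (hv0 : v 0 = idPt E G) (hu : HasDerivAt u X 0) (hv : HasDerivAt v Y 0) :
    Filter.Tendsto (fun s : ℝ => (s ^ 2)⁻¹ • (chartMul G (u s) (v s) - chartMul G (v s) (u s)))
      (nhdsWithin 0 {0}ᶜ) (nhds (mulMixed E G X Y - mulMixed E G Y X)) := by
  have main : ∀ {u v : ℝ → E} {X Y : E}, u 0 = idPt E G → v 0 = idPt E G → HasDerivAt u X 0 →
      HasDerivAt v Y 0 → Filter.Tendsto (fun s : ℝ => (s ^ 2)⁻¹ •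
        (chartMul G (u s) (v s) - (u s + v s - idPt E G)))
      (nhdsWithin 0 {0}ᶜ) (nhds (mulMixed E G X Y)) := by
    intro u v X Y hu0 hv0 hu hv
    have h1 : Filter.Tendsto (fun s => (u s, v s)) (nhds 0) (nhds (idPt E G, idPt E G)) := by
      have h2 := hu.continuousAt.tendsto.prodMk_nhds hv.continuousAt.tendsto
      rwa [hu0, hv0] at h2
    have h2 := ((chartMul_sub_isLittleO E G).comp_tendsto h1)
    have hO : (fun s => ‖u s - idPt E G‖ * ‖v s - idPt E G‖) =O[nhds 0] fun s => s ^ 2 := by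
      have hu1 := hu.isBigO_sub.norm_left
      have hv1 := hv.isBigO_sub.norm_left
      rw [hu0] at hu1
      rw [hv0] at hv1
      simpa [sq] using hu1.mul hv1
    have h3 := (h2.trans_isBigO hO).mono (nhdsWithin_le_nhds (s := {0}ᶜ))
    have h4 : Filter.Tendsto (fun s : ℝ => (s ^ 2)⁻¹ • (chartMul G (u s) (v s) -
        (u s + v s - idPt E G) - mulMixed E G (u s - idPt E G) (v s - idPt E G)))
        (nhdsWithin 0 {0}ᶜ) (nhds 0) := h3.tendsto_inv_smul_nhds_zero
    have h5 : Filter.Tendsto (fun s : ℝ => (s ^ 2)⁻¹ •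
        mulMixed E G (u s - idPt E G) (v s - idPt E G))
        (nhdsWithin 0 {0}ᶜ) (nhds (mulMixed E G X Y)) := by
      have hu2 := hasDerivAt_iff_tendsto_slope.1 hu
      have hv2 := hasDerivAt_iff_tendsto_slope.1 hv
      have hc : Continuous fun z : E × E => mulMixed E G z.1 z.2 :=
        (mulMixed E G).continuous₂
      refine ((hc.tendsto (X, Y)).comp (hu2.prodMk_nhds hv2)).congr fun s => ?_
      simp only [Function.comp_apply, slope_def_module, hu0, hv0, sub_zero, map_smul,
        _root_.smul_apply, smul_smul, sq, mul_inv]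
    simpa [← smul_add] using h4.add h5
  refine ((main hu0 hv0 hu hv).sub (main hv0 hu0 hv hu)).congr fun s => ?_
  rw [← smul_sub, add_comm (v s)]
  simp

theorem tendsto_chart_commutator {x y : ℝ → G} {X Y : GroupLieAlgebra 𝓘(ℝ, E) G}
    (hx0 : x 0 = 1) (hy0 : y 0 = 1)
    (hx : HasMFDerivAt 𝓘(ℝ, ℝ) 𝓘(ℝ, E) x 0 ((1 : ℝ →L[ℝ] ℝ).smulRight
      (mulInvariantVectorField X (x 0))))
    (hy : HasMFDerivAt 𝓘(ℝ, ℝ) 𝓘(ℝ, E) y 0 ((1 : ℝ →L[ℝ] ℝ).smulRight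
      (mulInvariantVectorField Y (y 0)))) :
    Filter.Tendsto (fun s : ℝ => (s ^ 2)⁻¹ • (extChartAt 𝓘(ℝ, E) (1 : G) (x s * y s) -
      extChartAt 𝓘(ℝ, E) (1 : G) (y s * x s)))
      (nhdsWithin 0 {0}ᶜ) (nhds (lieCoord E G ⁅X, Y⁆)) := by
  have key : ∀ {x : ℝ → G} {X : GroupLieAlgebra 𝓘(ℝ, E) G}, x 0 = 1 →
      HasMFDerivAt 𝓘(ℝ, ℝ) 𝓘(ℝ, E) x 0 ((1 : ℝ →L[ℝ] ℝ).smulRight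
      (mulInvariantVectorField X (x 0))) →
      HasDerivAt (fun s => extChartAt 𝓘(ℝ, E) (1 : G) (x s)) (lieCoord E G X) 0 ∧
      ∀ᶠ s in nhds 0, x s ∈ (extChartAt 𝓘(ℝ, E) (1 : G)).source := by
    intro x X hx0 hx
    have h1 : x 0 ∈ (extChartAt 𝓘(ℝ, E) (1 : G)).source := by
      rw [hx0]; exact mem_of_mem_nhds source_mem_nhds
    have h2 := hasDerivAt_chart_comp hx h1
    rw [hx0, show extChartAt 𝓘(ℝ, E) (1 : G) 1 = idPt E G from rfl, leftFrame_idPt] at h2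
    refine ⟨h2, hx.1.tendsto.eventually ?_⟩
    rw [hx0]
    exact source_mem_nhds
  obtain ⟨hx1, hx2⟩ := key hx0 hx
  obtain ⟨hy1, hy2⟩ := key hy0 hy
  rw [bracket_eq_mulMixed]
  refine (tendsto_chartMul_commutator (G := G) (by simp [hx0, idPt]) (by simp [hy0, idPt])
    hx1 hy1).congr' ?_
  filter_upwards [nhdsWithin_le_nhds hx2, nhdsWithin_le_nhds hy2] with s hs1 hs2
  simp only [chartMul, PartialEquiv.left_inv _ hs1, PartialEquiv.left_inv _ hs2]

end Commutator

/-! ### A lower bound for the Carnot–Carathéodory distance -/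

section Horizontal

variable {E : Type*} [NormedAddCommGroup E] [NormedSpace ℝ E]
  {G : Type*} [TopologicalSpace G] [ChartedSpace E G] [Group G] [LieGroup 𝓘(ℝ, E) ∞ G]

variable (E G) in
theorem exists_leftFrame_bound : ∃ r > 0, ∃ M : ℝ≥0,
    Metric.closedBall (idPt E G) r ⊆ (extChartAt 𝓘(ℝ, E) (1 : G)).target ∧
    ∀ z ∈ Metric.closedBall (idPt E G) r, ‖leftFrame G z‖₊ ≤ M ∧
      ‖leftFrame G z - ContinuousLinearMap.id ℝ E‖₊ ≤ M * ‖z - idPt E G‖₊ := by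
  obtain ⟨K, t, ht, hK⟩ := (contDiffAt_leftFrame (E := E) (G := G)).exists_lipschitzOnWith
  obtain ⟨r, hr, hrt⟩ := Metric.nhds_basis_closedBall.mem_iff.1
    (Filter.inter_mem ht (target_mem_nhds (E := E) (G := G)))
  have h1 : ∀ z ∈ Metric.closedBall (idPt E G) r,
      ‖leftFrame G z - ContinuousLinearMap.id ℝ E‖₊ ≤ K * ‖z - idPt E G‖₊ := by
    intro z hz
    have h2 := hK.dist_le_mul z (hrt hz).1 (idPt E G) (mem_of_mem_nhds ht)
    rw [leftFrame_idPt, dist_eq_norm, dist_eq_norm] at h2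
    exact_mod_cast h2
  refine ⟨r, hr, K * r.toNNReal + 1 + K, fun z hz => (hrt hz).2, fun z hz => ⟨?_, ?_⟩⟩
  · have h3 : ‖z - idPt E G‖₊ ≤ r.toNNReal := by
      rw [Metric.mem_closedBall, dist_eq_norm] at hz
      exact NNReal.le_toNNReal_of_coe_le hz
    calc ‖leftFrame G z‖₊ = ‖(leftFrame G z - ContinuousLinearMap.id ℝ E) +
          ContinuousLinearMap.id ℝ E‖₊ := by simp
      _ ≤ ‖leftFrame G z - ContinuousLinearMap.id ℝ E‖₊ + ‖ContinuousLinearMap.id ℝ E‖₊ :=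
          nnnorm_add_le _ _
      _ ≤ K * r.toNNReal + 1 := by
          gcongr
          · exact (h1 z hz).trans (by gcongr)
          · exact ContinuousLinearMap.norm_id_le
      _ ≤ _ := le_self_add
  · exact (h1 z hz).trans (by gcongr; exact le_add_self)

variable {V₁ : Submodule ℝ (GroupLieAlgebra 𝓘(ℝ, E) G)} {γ : ℝ → G} {u : ℝ → V₁} {a b : ℝ}

omit [LieGroup 𝓘(ℝ, E) ∞ G] in
theorem IsHorizontalCurve.mono (hγ : IsHorizontalCurve V₁ γ u a b) {t : ℝ} (ht : t ≤ b) :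
    IsHorizontalCurve V₁ γ u a t where
  ac := ⟨hγ.ac.1.mono (Icc_subset_Icc_right ht), fun p c d hac hcd hdt hm =>
    hγ.ac.2 p c d hac hcd (hdt.trans ht) hm⟩
  velocity := ae_restrict_of_ae_restrict_of_subset (Icc_subset_Icc_right ht) hγ.velocity

omit [LieGroup 𝓘(ℝ, E) ∞ G] in
theorem horizontalLength_mono (g : InnerProductSpace.Core ℝ V₁) {t : ℝ} (ht : t ≤ b) :
    horizontalLength g u a t ≤ horizontalLength g u a b :=
  lintegral_mono_set (Icc_subset_Icc_right ht)

/-- A left translate of a horizontal curve in the chart, followed by a linear map `T`, has length at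
most `k` times its horizontal length, when `T` is bounded by `k` on horizontal vectors along it. -/
theorem edist_le_mul_horizontalLength {F : Type*} [NormedAddCommGroup F] [NormedSpace ℝ F]
    (g : InnerProductSpace.Core ℝ V₁) (hγ : IsHorizontalCurve V₁ γ u a b) (hab : a ≤ b) (q : G)
    (hac : AbsolutelyContinuousOnInterval
      (fun t => extChartAt 𝓘(ℝ, E) (1 : G) (q * γ t)) a b)
    (hsrc : ∀ t ∈ Icc a b, q * γ t ∈ (extChartAt 𝓘(ℝ, E) (1 : G)).source)
    (T : E →L[ℝ] F) (k : ℝ≥0)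
    (hk : ∀ t ∈ Icc a b, ∀ v : V₁, ‖T (leftFrame G (extChartAt 𝓘(ℝ, E) (1 : G) (q * γ t))
      (lieCoord E G v))‖ₑ ≤ k * ENNReal.ofReal √(g.inner v v)) :
    edist (T (extChartAt 𝓘(ℝ, E) (1 : G) (q * γ a))) (T (extChartAt 𝓘(ℝ, E) (1 : G) (q * γ b)))
      ≤ k * horizontalLength g u a b := by
  rw [horizontalLength, ← lintegral_const_mul' _ _ ENNReal.coe_ne_top]
  refine edist_le_lintegral_of_absolutelyContinuous
    (h := fun t => T (extChartAt 𝓘(ℝ, E) (1 : G) (q * γ t)))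
    (h' := fun t => T (leftFrame G (extChartAt 𝓘(ℝ, E) (1 : G) (q * γ t)) (lieCoord E G (u t))))
    hab (hac.of_dist_le fun s _ t _ => T.lipschitz.dist_le_mul _ _) ?_ ?_
  · filter_upwards [hγ.velocity, ae_restrict_mem measurableSet_Icc] with t ht htab
    exact T.hasFDerivAt.comp_hasDerivAt t
      (hasDerivAt_chart_comp (hasMFDerivAt_mul_left q ht) (hsrc t htab))
  · filter_upwards [ae_restrict_mem measurableSet_Icc] with t htab
    exact hk t htab (u t)

/-- A short horizontal curve which starts near the identity stays in the chart domain, and its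
displacement in the chart is controlled by its length. -/
theorem IsHorizontalCurve.mem_source_and_edist_le [T2Space G] [FiniteDimensional ℝ E]
    (g : InnerProductSpace.Core ℝ V₁)
    (hγ : IsHorizontalCurve V₁ γ u a b) {r : ℝ} {M C : ℝ≥0} (hr : 0 < r)
    (hball : Metric.closedBall (idPt E G) r ⊆ (extChartAt 𝓘(ℝ, E) (1 : G)).target)
    (hM : ∀ z ∈ Metric.closedBall (idPt E G) r, ‖leftFrame G z‖₊ ≤ M)
    (hC : ∀ v : V₁, ‖lieCoord E G v‖ₑ ≤ C * ENNReal.ofReal √(g.inner v v))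
    (hsrc : γ a ∈ (extChartAt 𝓘(ℝ, E) (1 : G)).source)
    (ha : dist (extChartAt 𝓘(ℝ, E) (1 : G) (γ a)) (idPt E G) < r / 2)
    (hl : (M * C : ℝ≥0) * horizontalLength g u a b < ENNReal.ofReal (r / 2)) :
    ∀ t ∈ Icc a b, γ t ∈ (extChartAt 𝓘(ℝ, E) (1 : G)).source ∧
      edist (extChartAt 𝓘(ℝ, E) (1 : G) (γ a)) (extChartAt 𝓘(ℝ, E) (1 : G) (γ t)) ≤
        (M * C : ℝ≥0) * horizontalLength g u a b := by
  set φ := extChartAt 𝓘(ℝ, E) (1 : G) with hφ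
  -- `step` is the estimate while the curve stays in `O`; `hstay` looks at the first exit time
  set O : Set G := φ.source ∩ φ ⁻¹' Metric.ball (idPt E G) r
  have hOo : IsOpen O := (continuousOn_extChartAt (1 : G)).isOpen_inter_preimage
    (isOpen_extChartAt_source (1 : G)) Metric.isOpen_ball
  have step : ∀ t ∈ Icc a b, (∀ τ ∈ Icc a t, γ τ ∈ O) →
      edist (φ (γ a)) (φ (γ t)) ≤ (M * C : ℝ≥0) * horizontalLength g u a b := by
    intro t ht hτ
    have hac : AbsolutelyContinuousOnInterval (fun t => φ (γ t)) a t := by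
      refine hγ.ac.2 1 a t le_rfl ht.1 ht.2 fun τ h => ?_
      have := (hτ τ h).1
      rwa [hφ, extChartAt_source] at this
    have h1 := edist_le_mul_horizontalLength g (hγ.mono ht.2) ht.1 1
      (by simpa only [one_mul] using hac) (fun τ h => by simpa only [one_mul] using (hτ τ h).1)
      (ContinuousLinearMap.id ℝ E) (M * C) (by
        intro τ h v
        have h2 := hM _ (Metric.ball_subset_closedBall (hτ τ h).2)
        simp only [one_mul, ContinuousLinearMap.id_apply]
        refine ((leftFrame G (φ (γ τ))).le_opENorm _).trans ?_
        rw [ENNReal.coe_mul, mul_assoc]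
        gcongr
        · exact_mod_cast h2
        · exact hC v)
    simp only [one_mul, ContinuousLinearMap.id_apply] at h1
    exact h1.trans (by gcongr; exact horizontalLength_mono g ht.2)
  have hstay : ∀ t ∈ Icc a b, γ t ∈ O := by
    by_contra! hne
    obtain ⟨t₀, ht₀, ht₀O⟩ := hne
    set B : Set ℝ := Icc a b ∩ γ ⁻¹' Oᶜ
    have hBc : IsClosed B := hγ.ac.1.preimage_isClosed_of_isClosed isClosed_Icc hOo.isClosed_compl
    have hBne : B.Nonempty := ⟨t₀, ht₀, ht₀O⟩
    have hBb : BddBelow B := ⟨a, fun t ht => ht.1.1⟩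
    have hτB : sInf B ∈ B := hBc.csInf_mem hBne hBb
    set τ := sInf B
    have hbefore : ∀ t ∈ Ico a τ, γ t ∈ O := by
      intro t ht
      by_contra h
      exact absurd (csInf_le hBb (show t ∈ B from ⟨⟨ht.1, ht.2.le.trans hτB.1.2⟩, h⟩))
        (not_le.2 ht.2)
    have haO : γ a ∈ O := ⟨hsrc, by
      simp only [mem_preimage, Metric.mem_ball]; linarith⟩
    have haτ : a < τ := lt_of_le_of_ne hτB.1.1 fun h => hτB.2 (h ▸ haO)
    -- before the exit time the curve is in the compact subset `K` of `O`, hence also at that time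
    set K : Set G := φ.symm '' Metric.closedBall (φ (γ a)) (r / 2)
    have hsub : Metric.closedBall (φ (γ a)) (r / 2) ⊆ Metric.ball (idPt E G) r := by
      refine Metric.closedBall_subset_ball' ?_
      linarith
    have hKc : IsClosed K := by
      refine IsCompact.isClosed ((isCompact_closedBall _ _).image_of_continuousOn ?_)
      exact (continuousOn_extChartAt_symm (1 : G)).mono
        (hsub.trans (Metric.ball_subset_closedBall.trans hball))
    have hKO : K ⊆ O := by
      rintro _ ⟨z, hz, rfl⟩
      have hz' := hball (Metric.ball_subset_closedBall (hsub hz))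
      refine ⟨φ.map_target hz', ?_⟩
      rw [mem_preimage, φ.right_inv hz']
      exact hsub hz
    have hmem : ∀ t ∈ Ico a τ, γ t ∈ K := by
      intro t ht
      refine ⟨φ (γ t), ?_, φ.left_inv (hbefore t ht).1⟩
      have h1 := (step t ⟨ht.1, ht.2.le.trans hτB.1.2⟩
        fun σ hσ => hbefore σ ⟨hσ.1, hσ.2.trans_lt ht.2⟩).trans_lt hl
      rw [edist_dist, ENNReal.ofReal_lt_ofReal_iff (by positivity)] at h1
      rw [Metric.mem_closedBall, dist_comm]
      exact h1.le
    have hcl : γ τ ∈ closure K := by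
      have h1 : τ ∈ closure (Ico a τ) := by
        rw [closure_Ico haτ.ne]; exact ⟨haτ.le, le_rfl⟩
      have h2 : ContinuousWithinAt γ (Ico a τ) τ :=
        (hγ.ac.1 τ hτB.1).mono (Ico_subset_Icc_self.trans (Icc_subset_Icc_right hτB.1.2))
      exact h2.mem_closure h1 hmem
    rw [hKc.closure_eq] at hcl
    exact hτB.2 (hKO hcl)
  exact fun t ht => ⟨(hstay t ht).1, step t ht fun τ h => hstay τ ⟨h.1, h.2.trans ht.2⟩⟩

/-- A linear form `Λ` which vanishes on horizontal vectors at the identity varies little along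
horizontal curves near the identity: on them `Λ` of the velocity is bounded by the speed times the
distance to the identity, up to a constant. The estimate is for the left translate by `q` of a
curve from `p` to `p'` of length less than `ℓ`, uniformly in `q`. -/
theorem exists_normal_estimate [T2Space G] [FiniteDimensional ℝ E]
    (g : InnerProductSpace.Core ℝ V₁) (Λ : E →L[ℝ] ℝ) (hΛ : ∀ v : V₁, Λ (lieCoord E G v) = 0) :
    ∃ C : ℝ≥0, ∃ δ > 0, ∃ U ∈ nhds (1 : G), ∀ q ∈ U, ∀ p ∈ U, ∀ (p' : G) (ℓ : ℝ),
      ccEDist g p p' < ENNReal.ofReal ℓ → ℓ ≤ δ →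
      ‖Λ (extChartAt 𝓘(ℝ, E) (1 : G) (q * p)) - Λ (extChartAt 𝓘(ℝ, E) (1 : G) (q * p'))‖ ≤
        C * ℓ * (‖extChartAt 𝓘(ℝ, E) (1 : G) (q * p) - idPt E G‖ + ℓ) := by
  obtain ⟨r, hr, M, hball, hM⟩ := exists_leftFrame_bound E G
  have : FiniteDimensional ℝ (GroupLieAlgebra 𝓘(ℝ, E) G) :=
    (lieCoord E G).symm.finiteDimensional
  obtain ⟨C, hC⟩ := exists_norm_le_sqrt_inner g ((lieCoord E G).toLinearMap.comp V₁.subtype)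
  replace hC : ∀ v : V₁, ‖lieCoord E G v‖ₑ ≤ C * ENNReal.ofReal √(g.inner v v) := hC
  set φ := extChartAt 𝓘(ℝ, E) (1 : G) with hφ
  have hφ1 : φ 1 = idPt E G := rfl
  have hO₂ : φ.source ∩ φ ⁻¹' Metric.ball (idPt E G) r ∈ nhds (1 : G) := by
    refine Filter.inter_mem source_mem_nhds ((continuousAt_extChartAt (1 : G)).preimage_mem_nhds ?_)
    exact Metric.ball_mem_nhds _ hr
  have hmul : Filter.Tendsto (fun p : G × G => p.1 * p.2) (nhds 1 ×ˢ nhds 1) (nhds 1) := by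
    have := (contMDiff_mul 𝓘(ℝ, E) ∞ (G := G)).continuous.tendsto (1, 1)
    rwa [nhds_prod_eq, mul_one] at this
  obtain ⟨U₁, hU₁, O₁, hO₁, hUO⟩ := Filter.mem_prod_iff.1 (hmul hO₂)
  have hsymm : Filter.Tendsto φ.symm (nhds (idPt E G)) (nhds 1) := by
    have := (continuousAt_extChartAt_symm (I := 𝓘(ℝ, E)) (1 : G)).tendsto
    rwa [← hφ, hφ1, symm_idPt] at this
  obtain ⟨r₁, hr₁, hr₁'⟩ := Metric.nhds_basis_closedBall.mem_iff.1
    (Filter.inter_mem (hsymm hO₁) (Metric.closedBall_mem_nhds (idPt E G) hr))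
  -- curves shorter than `δ` move by at most `M * C * δ < r₁ / 2` in the chart
  set δ := r₁ / (4 * (M * C + 1)) with hδ
  have hδ0 : 0 < δ := by positivity
  refine ⟨‖Λ‖₊ * M * C * (1 + M * C), δ, hδ0,
    U₁ ∩ (φ.source ∩ φ ⁻¹' Metric.ball (idPt E G) (r₁ / 2)),
    Filter.inter_mem hU₁ (Filter.inter_mem source_mem_nhds
      ((continuousAt_extChartAt (1 : G)).preimage_mem_nhds
        (Metric.ball_mem_nhds _ (by positivity)))), ?_⟩
  rintro q ⟨hq, -⟩ p ⟨-, hp, hp'⟩ p' ℓ hpp hℓ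
  obtain ⟨_, ⟨a, b, γ, u, hab, rfl, rfl, hγ, rfl⟩, hlen⟩ := sInf_lt_iff.1 hpp
  have hℓ0 : 0 < ℓ := ENNReal.ofReal_pos.1 (bot_le.trans_lt hpp)
  have hMC : (M * C : ℝ≥0) * horizontalLength g u a b ≤ ENNReal.ofReal (M * C * ℓ) := by
    rw [ENNReal.ofReal_mul (by positivity), ← NNReal.coe_mul, ENNReal.ofReal_coe_nnreal]
    gcongr
  have hMCℓ : M * C * ℓ < r₁ / 2 := by
    have : (M * C + 1 : ℝ) * δ = r₁ / 4 := by rw [hδ]; field_simp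
    have h2 : (M * C : ℝ) * ℓ ≤ (M * C + 1 : ℝ) * δ := by gcongr; linarith
    linarith
  have htrap := hγ.mem_source_and_edist_le g hr₁
    ((fun z hz => hball (hr₁' hz).2)) (fun z hz => (hM z (hr₁' hz).2).1) hC hp hp'
    (hMC.trans_lt ((ENNReal.ofReal_lt_ofReal_iff (by positivity)).2 hMCℓ))
  have hin : ∀ t ∈ Icc a b, φ (γ t) ∈ Metric.closedBall (idPt E G) r₁ := by
    intro t ht
    have h1 := (htrap t ht).2.trans hMC
    rw [edist_dist, ENNReal.ofReal_le_ofReal_iff (by positivity)] at h1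
    rw [mem_preimage, Metric.mem_ball] at hp'
    rw [Metric.mem_closedBall]
    linarith [dist_triangle_left (φ (γ t)) (idPt E G) (φ (γ a))]
  have hqO : ∀ z ∈ Metric.closedBall (idPt E G) r₁,
      q * φ.symm z ∈ φ.source ∩ φ ⁻¹' Metric.ball (idPt E G) r :=
    fun z hz => hUO (mk_mem_prod hq (hr₁' hz).1)
  have hsymmγ : ∀ t ∈ Icc a b, φ.symm (φ (γ t)) = γ t := fun t ht =>
    φ.left_inv (htrap t ht).1
  have hqγ : ∀ t ∈ Icc a b, q * γ t ∈ φ.source ∩ φ ⁻¹' Metric.ball (idPt E G) r := by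
    intro t ht
    have := hqO _ (hin t ht)
    rwa [hsymmγ t ht] at this
  have hcd : ContDiffOn ℝ 1 (fun z => φ (q * φ.symm z)) (Metric.closedBall (idPt E G) r₁) := by
    intro z hz
    refine ContDiffAt.contDiffWithinAt ?_
    rw [← contMDiffAt_iff_contDiffAt]
    refine ContMDiffAt.of_le (n := ∞) ?_ (by norm_cast)
    refine ContMDiffAt.comp (g := φ) z (contMDiffAt_chart (hqO z hz).1) ?_
    exact ContMDiffAt.comp (g := fun p : G => q * p) z (contMDiffAt_mul_left' q _)
      (contMDiffAt_symm (hball (hr₁' hz).2))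
  obtain ⟨K, hK⟩ := hcd.exists_lipschitzOnWith (by simp) (convex_closedBall _ _)
    (isCompact_closedBall _ _)
  have hacφ : AbsolutelyContinuousOnInterval (fun t => φ (γ t)) a b := by
    refine hγ.ac.2 1 a b le_rfl hab le_rfl fun t ht => ?_
    have := (htrap t ht).1
    rwa [extChartAt_source] at this
  have hac : AbsolutelyContinuousOnInterval (fun t => φ (q * γ t)) a b := by
    refine hacφ.of_dist_le (K := K) fun s hs t ht => ?_
    rw [uIcc_of_le hab] at hs ht
    have := hK.dist_le_mul _ (hin s hs) _ (hin t ht)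
    simpa only [hsymmγ s hs, hsymmγ t ht] using this
  have hdist : ∀ t ∈ Icc a b, dist (φ (q * γ a)) (φ (q * γ t)) ≤ M * C * ℓ := by
    intro t ht
    have h1 := edist_le_mul_horizontalLength g (hγ.mono ht.2) ht.1 q
      (hac.mono (by rw [uIcc_of_le ht.1, uIcc_of_le hab]; exact Icc_subset_Icc_right ht.2))
      (fun τ h => (hqγ τ ⟨h.1, h.2.trans ht.2⟩).1) (ContinuousLinearMap.id ℝ E) (M * C) (by
        intro τ h v
        have h2 := (hM _ (Metric.ball_subset_closedBall (hqγ τ ⟨h.1, h.2.trans ht.2⟩).2)).1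
        simp only [ContinuousLinearMap.id_apply]
        refine ((leftFrame G (φ (q * γ τ))).le_opENorm _).trans ?_
        rw [ENNReal.coe_mul, mul_assoc]
        gcongr
        · exact_mod_cast h2
        · exact hC v)
    simp only [ContinuousLinearMap.id_apply] at h1
    have h2 := (h1.trans (mul_le_mul_right (horizontalLength_mono g ht.2) _)).trans hMC
    rwa [edist_dist, ENNReal.ofReal_le_ofReal_iff (by positivity)] at h2
  -- `D` bounds the distance of the translated curve to the identity, hence of `leftFrame` to `id`
  set D : ℝ≥0 := ‖φ (q * γ a) - idPt E G‖₊ + M * C * ℓ.toNNReal with hD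
  have hDval : (D : ℝ) = ‖φ (q * γ a) - idPt E G‖ + M * C * ℓ := by
    simp [hD, Real.coe_toNNReal _ hℓ0.le]
  have h1 := edist_le_mul_horizontalLength g hγ hab q hac (fun t ht => (hqγ t ht).1) Λ
    (‖Λ‖₊ * (M * D) * C) (by
      intro t ht v
      have h2 := (hM _ (Metric.ball_subset_closedBall (hqγ t ht).2)).2
      have h3 : ‖φ (q * γ t) - idPt E G‖₊ ≤ D := by
        rw [← NNReal.coe_le_coe]
        rw [hDval, coe_nnnorm, ← dist_eq_norm, ← dist_eq_norm]
        linarith [hdist t ht, dist_triangle_left (φ (q * γ t)) (idPt E G) (φ (q * γ a))]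
      have h4 : Λ (leftFrame G (φ (q * γ t)) (lieCoord E G v)) =
          Λ ((leftFrame G (φ (q * γ t)) - ContinuousLinearMap.id ℝ E) (lieCoord E G v)) := by
        simp [hΛ v]
      rw [h4]
      refine (Λ.le_opENorm _).trans ?_
      simp only [ENNReal.coe_mul, mul_assoc]
      gcongr
      · exact le_rfl
      refine (ContinuousLinearMap.le_opENorm _ _).trans ?_
      rw [← mul_assoc]
      gcongr
      · exact_mod_cast h2.trans (by gcongr)
      · exact hC v)
  have h2 : edist (Λ (φ (q * γ a))) (Λ (φ (q * γ b))) ≤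
      ENNReal.ofReal ((‖Λ‖₊ * (M * D) * C : ℝ≥0) * ℓ) := by
    rw [ENNReal.ofReal_mul (by positivity), ENNReal.ofReal_coe_nnreal]
    exact h1.trans (by gcongr)
  rw [edist_dist, ENNReal.ofReal_le_ofReal_iff (by positivity), dist_eq_norm] at h2
  refine h2.trans ?_
  simp only [hDval, NNReal.coe_add, NNReal.coe_mul, coe_nnnorm, NNReal.coe_one]
  have h5 : ‖φ (q * γ a) - idPt E G‖ + M * C * ℓ ≤
      (1 + M * C) * (‖φ (q * γ a) - idPt E G‖ + ℓ) := by
    have h6 : 0 ≤ (M : ℝ) * C * ‖φ (q * γ a) - idPt E G‖ := by positivity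
    linear_combination h6 + hℓ0
  calc ‖Λ‖ * (M * (‖φ (q * γ a) - idPt E G‖ + M * C * ℓ)) * C * ℓ
      = ‖Λ‖ * M * C * ℓ * (‖φ (q * γ a) - idPt E G‖ + M * C * ℓ) := by ring
    _ ≤ ‖Λ‖ * M * C * ℓ * ((1 + M * C) * (‖φ (q * γ a) - idPt E G‖ + ℓ)) := by gcongr
    _ = _ := by ring

/-- If `⁅X, Y⁆` is not horizontal, then the distance between `x s * y s` and `y s * x s` is at least
linear in `s`, although the two points agree to first order in the chart. -/
theorem exists_le_ccEDist_commutator [T2Space G] [FiniteDimensional ℝ E]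
    (g : InnerProductSpace.Core ℝ V₁) {X Y : GroupLieAlgebra 𝓘(ℝ, E) G} (hXY : ⁅X, Y⁆ ∉ V₁)
    {x y : ℝ → G} (hx0 : x 0 = 1) (hy0 : y 0 = 1)
    (hx : HasMFDerivAt 𝓘(ℝ, ℝ) 𝓘(ℝ, E) x 0 ((1 : ℝ →L[ℝ] ℝ).smulRight
      (mulInvariantVectorField X (x 0))))
    (hy : HasMFDerivAt 𝓘(ℝ, ℝ) 𝓘(ℝ, E) y 0 ((1 : ℝ →L[ℝ] ℝ).smulRight
      (mulInvariantVectorField Y (y 0))))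
    (hx1 : ContMDiff 𝓘(ℝ, ℝ) 𝓘(ℝ, E) 1 x) (hy1 : ContMDiff 𝓘(ℝ, ℝ) 𝓘(ℝ, E) 1 y) :
    ∃ c > 0, ∃ s₀ > 0, ∃ U ∈ nhds (1 : G), ∀ q ∈ U, ∀ s : ℝ, 0 < s → s < s₀ →
      ENNReal.ofReal (c * s) ≤ ccEDist g (q * (y s * x s)) (q * (x s * y s)) := by
  have hcm := (contMDiff_mul 𝓘(ℝ, E) ∞ (G := G)).continuous
  have : ContinuousMul G := ⟨hcm⟩
  have hci : Continuous fun p : G => p⁻¹ := (contMDiff_inv 𝓘(ℝ, E) ∞).continuous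
  set φ := extChartAt 𝓘(ℝ, E) (1 : G) with hφ
  obtain ⟨Λ, hΛ1, hΛ2⟩ := Submodule.exists_dual_map_eq_bot_of_notMem
    (p := V₁.map (lieCoord E G).toLinearMap) (x := lieCoord E G ⁅X, Y⁆)
    (by
      rintro ⟨v, hv, hv'⟩
      exact hXY ((lieCoord E G).injective hv' ▸ hv)) inferInstance
  set Λ' : E →L[ℝ] ℝ := LinearMap.toContinuousLinearMap Λ with hΛ'
  have hΛ3 : ∀ v : V₁, Λ' (lieCoord E G v) = 0 := by
    intro v
    have h1 : Λ (lieCoord E G v) ∈ (V₁.map (lieCoord E G).toLinearMap).map Λ :=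
      Submodule.mem_map_of_mem (Submodule.mem_map_of_mem v.2)
    rw [hΛ2] at h1
    exact h1
  obtain ⟨C, δ, hδ, U, hU, hest⟩ := exists_normal_estimate g Λ' hΛ3
  set κ := ‖Λ' (lieCoord E G ⁅X, Y⁆)‖
  have hκ0 : 0 < κ := norm_pos_iff.2 hΛ1
  -- the two products differ by `s ^ 2 • ⁅X, Y⁆` to leading order
  have hlow : ∀ᶠ s in nhdsWithin (0 : ℝ) {0}ᶜ,
      κ / 2 * s ^ 2 ≤ ‖Λ' (φ (y s * x s)) - Λ' (φ (x s * y s))‖ := by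
    have h1 := ((Λ'.continuous.norm).tendsto _).comp
      (tendsto_chart_commutator hx0 hy0 hx hy)
    filter_upwards [h1.eventually_const_lt (show κ / 2 < κ by linarith), self_mem_nhdsWithin]
      with s hs hs0
    have hs2 : 0 < s ^ 2 := sq_pos_of_ne_zero hs0
    simp only [Function.comp_apply, map_smul, map_sub, smul_eq_mul, norm_mul, norm_inv,
      Real.norm_of_nonneg hs2.le] at hs
    rw [lt_inv_mul_iff₀ hs2] at hs
    rw [norm_sub_rev]
    linarith
  -- the product `y s * x s` is at distance `O(s)` from the identity
  obtain ⟨A, hA0, hA⟩ : ∃ A > 0, ∀ᶠ s in nhds (0 : ℝ), ‖φ (y s * x s) - idPt E G‖ ≤ A * ‖s‖ := by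
    have h1 : ContMDiffAt 𝓘(ℝ, ℝ) 𝓘(ℝ, E) 1 (fun s => y s * x s) 0 := by
      have : ContMDiffMul 𝓘(ℝ, E) 1 G := ContMDiffMul.of_le (n := ∞) (by norm_cast)
      exact (hy1 0).mul (hx1 0)
    have h2 : ContMDiffAt 𝓘(ℝ, ℝ) 𝓘(ℝ, E) 1 (fun s => φ (y s * x s)) 0 := by
      refine ContMDiffAt.comp (g := φ) 0 ((contMDiffAt_chart ?_).of_le (by norm_cast)) h1
      simp only [hx0, hy0, mul_one]
      exact mem_of_mem_nhds source_mem_nhds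
    have h3 := (h2.contDiffAt.differentiableAt (by simp)).isBigO_sub
    obtain ⟨A, hA, h4⟩ := h3.exists_pos
    refine ⟨A, hA, h4.bound.mono fun s hs => ?_⟩
    simpa [hx0, hy0, idPt, hφ] using hs
  have hnear : ∀ᶠ z : G × ℝ in nhds (1 : G) ×ˢ nhds (0 : ℝ),
      z.1⁻¹ ∈ U ∧ z.1 * (y z.2 * x z.2) ∈ U := by
    rw [← nhds_prod_eq]
    have h1 : Continuous fun z : G × ℝ => z.1 * (y z.2 * x z.2) := by
      have := hx1.continuous
      have := hy1.continuous
      fun_prop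
    have h2 : Continuous fun z : G × ℝ => z.1⁻¹ := hci.comp continuous_fst
    exact (h2.continuousAt.eventually_mem (by simpa using hU)).and
      (h1.continuousAt.eventually_mem (by simpa [hx0, hy0] using hU))
  obtain ⟨U', hU', S, hS, hUS⟩ := Filter.mem_prod_iff.1 hnear
  rw [eventually_nhdsWithin_iff] at hlow
  obtain ⟨s₁, hs₁, hball⟩ := Metric.eventually_nhds_iff_ball.1 ((hlow.and hA).and hS)
  -- a curve of length `c * s` changes `Λ'` by at most `C * c * (A + 1) * s ^ 2`, which is less than
  -- `κ / 2 * s ^ 2` for this `c`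
  set c := min 1 (κ / (4 * (C * (A + 1) + 1)))
  have hc0 : 0 < c := by positivity
  have hc1 : c ≤ 1 := min_le_left _ _
  have hc2 : c * (C * (A + 1)) < κ / 2 := by
    have h1 : c * (4 * (C * (A + 1) + 1)) ≤ κ := by
      rw [← le_div_iff₀ (by positivity)]; exact min_le_right _ _
    linarith
  refine ⟨c, hc0, min s₁ δ, lt_min hs₁ hδ, U', hU', fun q hq s hs0 hs => ?_⟩
  by_contra! hlt
  obtain ⟨⟨h1, h2⟩, h3⟩ := hball s (by
    rw [Metric.mem_ball, Real.dist_0_eq_abs, abs_of_pos hs0]; exact hs.trans_le (min_le_left _ _))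
  have h4 := hUS (mk_mem_prod hq h3)
  have hsδ : c * s ≤ δ := by
    calc c * s ≤ 1 * s := by gcongr
      _ ≤ δ := by rw [one_mul]; exact (hs.trans_le (min_le_right _ _)).le
  have h5 := hest q⁻¹ h4.1 _ h4.2 _ _ hlt hsδ
  simp only [inv_mul_cancel_left] at h5
  have h6 := (h1 hs0.ne').trans h5
  rw [Real.norm_of_nonneg hs0.le] at h2
  have h7 : C * (c * s) * (‖φ (y s * x s) - idPt E G‖ + c * s) ≤
      C * (c * s) * (A * s + 1 * s) := by gcongr
  have h8 : C * (c * s) * (A * s + 1 * s) = (c * (C * (A + 1))) * s ^ 2 := by ring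
  have h9 : (c * (C * (A + 1))) * s ^ 2 < κ / 2 * s ^ 2 := by gcongr
  linarith

end Horizontal

/-! ### The adjoint representation -/

section Adjoint

variable {E : Type*} [NormedAddCommGroup E] [NormedSpace ℝ E]
  {G : Type*} [TopologicalSpace G] [ChartedSpace E G] [Group G]

variable (E) in
/-- The adjoint map `Ad h`, the derivative at the identity of the conjugation by `h`, in the chart
at the identity. -/
noncomputable def adjointMap (h : G) : E →L[ℝ] E :=
  fderiv ℝ (fun v => extChartAt 𝓘(ℝ, E) (1 : G)
    (h * (extChartAt 𝓘(ℝ, E) (1 : G)).symm v * h⁻¹)) (idPt E G)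

variable [LieGroup 𝓘(ℝ, E) ∞ G]

theorem contMDiff_conj (h : G) : ContMDiff 𝓘(ℝ, E) 𝓘(ℝ, E) ∞ (fun p : G => h * p * h⁻¹) :=
  (contMDiff_mul_right (a := h⁻¹)).comp (contMDiff_mul_left (a := h))

theorem hasFDerivAt_conj (h : G) : HasFDerivAt (fun v => extChartAt 𝓘(ℝ, E) (1 : G)
    (h * (extChartAt 𝓘(ℝ, E) (1 : G)).symm v * h⁻¹)) (adjointMap E h) (idPt E G) := by
  refine DifferentiableAt.hasFDerivAt ?_
  refine ContDiffAt.differentiableAt (n := ∞) ?_ (by simp)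
  rw [← contMDiffAt_iff_contDiffAt]
  refine ContMDiffAt.comp (g := extChartAt 𝓘(ℝ, E) (1 : G)) _ (contMDiffAt_chart ?_) ?_
  · simpa only [symm_idPt, mul_one, mul_inv_cancel] using mem_of_mem_nhds source_mem_nhds
  · exact ContMDiffAt.comp (g := fun p : G => h * p * h⁻¹) _ (contMDiff_conj h _)
      (contMDiffAt_symm (mem_of_mem_nhds target_mem_nhds))

theorem tendsto_symm : Filter.Tendsto (extChartAt 𝓘(ℝ, E) (1 : G)).symm (nhds (idPt E G))
    (nhds 1) := by
  have := (contMDiffAt_symm (E := E) (G := G)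
    (mem_of_mem_nhds target_mem_nhds)).continuousAt.tendsto
  rwa [symm_idPt] at this

theorem tendsto_conj_symm (h : G) :
    Filter.Tendsto (fun v : E => h * (extChartAt 𝓘(ℝ, E) (1 : G)).symm v * h⁻¹)
      (nhds (idPt E G)) (nhds 1) := by
  have := ((contMDiff_conj (E := E) h).continuous.tendsto 1).comp (tendsto_symm (E := E) (G := G))
  simp only [mul_one, mul_inv_cancel] at this
  exact this

theorem adjointMap_mul (h₁ h₂ : G) :
    adjointMap E (h₁ * h₂) = (adjointMap E h₁).comp (adjointMap E h₂) := by
  have h2 := hasFDerivAt_conj (E := E) h₂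
  have h1 := hasFDerivAt_conj (E := E) h₁
  have he : extChartAt 𝓘(ℝ, E) (1 : G)
      (h₂ * (extChartAt 𝓘(ℝ, E) (1 : G)).symm (idPt E G) * h₂⁻¹) = idPt E G := by
    rw [symm_idPt, mul_one, mul_inv_cancel]; rfl
  replace h1 : HasFDerivAt (fun v => extChartAt 𝓘(ℝ, E) (1 : G)
      (h₁ * (extChartAt 𝓘(ℝ, E) (1 : G)).symm v * h₁⁻¹)) (adjointMap E h₁)
      (extChartAt 𝓘(ℝ, E) (1 : G)
      (h₂ * (extChartAt 𝓘(ℝ, E) (1 : G)).symm (idPt E G) * h₂⁻¹)) := by rwa [he]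
  refine HasFDerivAt.unique (hasFDerivAt_conj (h₁ * h₂))
    ((h1.comp (idPt E G) h2).congr_of_eventuallyEq ?_)
  filter_upwards [(tendsto_conj_symm (E := E) h₂).eventually (source_mem_nhds (E := E))] with v hv
  simp only [Function.comp_apply] at hv ⊢
  rw [PartialEquiv.left_inv _ hv]
  congr 1
  group

omit [LieGroup 𝓘(ℝ, E) ∞ G] in
theorem adjointMap_one : adjointMap E (1 : G) = ContinuousLinearMap.id ℝ E := by
  rw [adjointMap, ← fderiv_id (𝕜 := ℝ) (x := idPt E G)]
  refine Filter.EventuallyEq.fderiv_eq ?_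
  filter_upwards [target_mem_nhds (E := E) (G := G)] with v hv
  simp only [one_mul, inv_one, mul_one, id, PartialEquiv.right_inv _ hv]

theorem contDiffAt_chartConj : ContDiffAt ℝ 2 (fun z : E × E => extChartAt 𝓘(ℝ, E) (1 : G)
    ((extChartAt 𝓘(ℝ, E) (1 : G)).symm z.1 * (extChartAt 𝓘(ℝ, E) (1 : G)).symm z.2 *
      ((extChartAt 𝓘(ℝ, E) (1 : G)).symm z.1)⁻¹)) (idPt E G, idPt E G) := by
  refine ContDiffAt.of_le (n := ∞) ?_ (by norm_cast)
  rw [← contMDiffAt_iff_contDiffAt]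
  have h1 : ContMDiffAt 𝓘(ℝ, E × E) 𝓘(ℝ, E) ∞ (fun z : E × E =>
      (extChartAt 𝓘(ℝ, E) (1 : G)).symm z.1) (idPt E G, idPt E G) :=
    (contMDiffAt_symm (mem_extChartAt_target (I := 𝓘(ℝ, E)) (1 : G))).comp
      (idPt E G, idPt E G) contDiffAt_fst.contMDiffAt
  have h2 : ContMDiffAt 𝓘(ℝ, E × E) 𝓘(ℝ, E) ∞ (fun z : E × E =>
      (extChartAt 𝓘(ℝ, E) (1 : G)).symm z.2) (idPt E G, idPt E G) :=
    (contMDiffAt_symm (mem_extChartAt_target (I := 𝓘(ℝ, E)) (1 : G))).comp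
      (idPt E G, idPt E G) contDiffAt_snd.contMDiffAt
  refine ContMDiffAt.comp (g := extChartAt 𝓘(ℝ, E) (1 : G)) (idPt E G, idPt E G) ?_
    ((h1.mul h2).mul h1.inv)
  simp only [symm_idPt, mul_one, inv_one]
  exact contMDiffAt_chart (mem_extChartAt_source (I := 𝓘(ℝ, E)) (1 : G))

theorem exists_hasFDerivAt_adjointMap_symm : ∃ L : E →L[ℝ] E →L[ℝ] E,
    HasFDerivAt (fun u => adjointMap E ((extChartAt 𝓘(ℝ, E) (1 : G)).symm u)) L (idPt E G) :=
  ⟨_, (contDiffAt_chartConj (E := E) (G := G)).hasFDerivAt_partial_right⟩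

/-- Differentiation of `p * q = (p * q * p⁻¹) * p` with respect to `q` at the identity: the left
translate of a vector is the right translate of its image under the adjoint map. -/
theorem leftFrame_eventuallyEq_adjointMap (w : E) :
    (fun u => leftFrame G u w) =ᶠ[nhds (idPt E G)] fun u =>
      fderiv ℝ (fun z : E × E => chartMul G z.1 z.2) (idPt E G, u)
        (adjointMap E ((extChartAt 𝓘(ℝ, E) (1 : G)).symm u) w, 0) := by
  set φ := extChartAt 𝓘(ℝ, E) (1 : G) with hφ
  have h1 : Filter.Tendsto (fun u : E => (idPt E G, u)) (nhds (idPt E G))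
      (nhds (idPt E G, idPt E G)) := (Continuous.prodMk_right _).tendsto _
  filter_upwards [h1.eventually ((contDiffAt_chartMul_two (E := E) (G := G)).eventually (by simp))]
    with u hu
  have hΦ := (hu.differentiableAt (by simp)).hasFDerivAt
  have hC := hasFDerivAt_conj (E := E) (φ.symm u)
  have he : φ (φ.symm u * φ.symm (idPt E G) * (φ.symm u)⁻¹) = idPt E G := by
    rw [symm_idPt, mul_one, mul_inv_cancel]; rfl
  rw [← he] at hΦ
  have h2 := hΦ.comp (idPt E G) (hC.prodMk (hasFDerivAt_const (𝕜 := ℝ) u (idPt E G)))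
  have h3 := h2.congr_of_eventuallyEq (f₁ := chartMul G u) (by
    filter_upwards [(tendsto_conj_symm (E := E) (φ.symm u)).eventually
      (source_mem_nhds (E := E))] with v hv
    simp only [Function.comp_apply] at hv ⊢
    rw [chartMul, chartMul, ← hφ, φ.left_inv hv]
    rw [inv_mul_cancel_right])
  have h4 : leftFrame G u = _ := h3.fderiv
  rw [h4, he]
  simp

theorem fderiv_chartMul_inl (a : E) :
    fderiv ℝ (fun z : E × E => chartMul G z.1 z.2) (idPt E G, idPt E G) (a, 0) = a := by
  have h1 : HasFDerivAt (fun v : E => chartMul G v (idPt E G)) _ (idPt E G) :=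
    ((contDiffAt_chartMul_two (E := E) (G := G)).differentiableAt
      (by simp)).hasFDerivAt.comp (f := fun v => (v, idPt E G)) (idPt E G)
      (hasFDerivAt_prodMk_left (idPt E G) (idPt E G))
  have h2 : HasFDerivAt (fun v : E => chartMul G v (idPt E G)) (ContinuousLinearMap.id ℝ E)
      (idPt E G) := by
    refine (hasFDerivAt_id _).congr_of_eventuallyEq ?_
    filter_upwards [target_mem_nhds (E := E) (G := G)] with v hv
    exact chartMul_idPt_right hv
  simpa using congrArg (fun T => T a) (h1.unique h2)

/-- The derivative of the adjoint representation is the bracket. -/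
theorem hasDerivAt_adjointMap {x : ℝ → G} {X Y : GroupLieAlgebra 𝓘(ℝ, E) G} (hx0 : x 0 = 1)
    (hx : HasMFDerivAt 𝓘(ℝ, ℝ) 𝓘(ℝ, E) x 0 ((1 : ℝ →L[ℝ] ℝ).smulRight
      (mulInvariantVectorField X (x 0)))) :
    HasDerivAt (fun t => adjointMap E (x t) (lieCoord E G Y)) (lieCoord E G ⁅X, Y⁆) 0 := by
  set w := lieCoord E G Y
  obtain ⟨L, hL⟩ := exists_hasFDerivAt_adjointMap_symm (E := E) (G := G)
  have hΦ2 := contDiffAt_chartMul_two (E := E) (G := G)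
  set D := fderiv ℝ (fderiv ℝ (fun z : E × E => chartMul G z.1 z.2)) (idPt E G, idPt E G)
  have hΦ1 : HasFDerivAt (fderiv ℝ (fun z : E × E => chartMul G z.1 z.2)) D
      (idPt E G, idPt E G) :=
    ((hΦ2.fderiv_right (m := 1) (by norm_num)).differentiableAt (by simp)).hasFDerivAt
  have h1 : HasFDerivAt (fun u => leftFrame G u) (mulMixed E G) (idPt E G) :=
    hΦ2.hasFDerivAt_partial_right
  have h1w := h1.clm_apply (hasFDerivAt_const w (idPt E G))
  have hLw := hL.clm_apply (hasFDerivAt_const w (idPt E G))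
  have h2 : HasFDerivAt (fun u => fderiv ℝ (fun z : E × E => chartMul G z.1 z.2) (idPt E G, u)) _
      (idPt E G) := hΦ1.comp (idPt E G) (hasFDerivAt_prodMk_right (idPt E G) (idPt E G))
  have h3 := h2.clm_apply (hLw.prodMk (hasFDerivAt_const (0 : E) (idPt E G)))
  have h4 := h1w.unique (h3.congr_of_eventuallyEq (leftFrame_eventuallyEq_adjointMap w))
  have hsymm : ∀ a b, D a b = D b a := fun a b =>
    (hΦ2.isSymmSndFDerivAt (by simp)).eq a b
  -- `h4` says that `mulMixed X w` is the derivative of the adjoint map plus `mulMixed w X`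
  have h5 := congrArg (fun T => T (lieCoord E G X)) h4
  simp only [ContinuousLinearMap.comp_apply, _root_.add_apply,
    ContinuousLinearMap.flip_apply, ContinuousLinearMap.prod_apply, symm_idPt, adjointMap_one,
    ContinuousLinearMap.id_apply, _root_.zero_apply, map_zero, zero_add,
    ContinuousLinearMap.inr_apply, fderiv_chartMul_inl] at h5
  have h6 : L (lieCoord E G X) w = lieCoord E G ⁅X, Y⁆ := by
    have h7 : D (0, lieCoord E G X) (w, 0) = mulMixed E G w (lieCoord E G X) := hsymm _ _
    rw [bracket_eq_mulMixed, h5, h7, add_sub_cancel_right]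
  have hs : x 0 ∈ (extChartAt 𝓘(ℝ, E) (1 : G)).source := by
    rw [hx0]; exact mem_of_mem_nhds source_mem_nhds
  have h8 := hasDerivAt_chart_comp hx hs
  have he : idPt E G = extChartAt 𝓘(ℝ, E) (1 : G) (x 0) := by rw [hx0]; rfl
  rw [he] at hLw
  have h9 := hLw.comp_hasDerivAt (0 : ℝ) h8
  rw [← he] at h9
  simp only [leftFrame_idPt, ContinuousLinearMap.comp_zero, zero_add,
    ContinuousLinearMap.flip_apply, ContinuousLinearMap.id_apply, h6] at h9
  refine h9.congr_of_eventuallyEq ?_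
  have h10 : ∀ᶠ t in nhds 0, x t ∈ (extChartAt 𝓘(ℝ, E) (1 : G)).source := by
    refine hx.1.tendsto.eventually ?_
    rw [hx0]; exact source_mem_nhds
  filter_upwards [h10] with t ht
  simp only [Function.comp_apply, PartialEquiv.left_inv _ ht]

end Adjoint

/-! ### Subadditive functions which are small along horizontal directions -/

section Chow

variable {E : Type*} [NormedAddCommGroup E] [NormedSpace ℝ E]
  {G : Type*} [TopologicalSpace G] [ChartedSpace E G] [Group G]

/-- `N` is a subadditive, symmetric function on the group which tends to `0` along a one-parameter
subgroup in every direction of `V₁`. It plays the role of the distance to the identity and may take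
the value `∞`. -/
structure IsSmallAlong (V₁ : Submodule ℝ (GroupLieAlgebra 𝓘(ℝ, E) G)) (N : G → ℝ≥0∞) :
    Prop where
  one : N 1 = 0
  mul_le : ∀ h k, N (h * k) ≤ N h + N k
  inv : ∀ h, N h⁻¹ = N h
  tendsto : ∀ X ∈ V₁, ∃ x : ℝ → G, IsOneParameterSubgroup X x ∧
    Filter.Tendsto (fun t => N (x t)) (nhds 0) (nhds 0)

/-- The span of the vectors `Ad h X` with `X ∈ V₁` and `N h < ε`. -/
def adjointSpan (V₁ : Submodule ℝ (GroupLieAlgebra 𝓘(ℝ, E) G)) (N : G → ℝ≥0∞) (ε : ℝ≥0∞) :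
    Submodule ℝ E :=
  Submodule.span ℝ {z | ∃ h : G, N h < ε ∧ ∃ X ∈ V₁, z = adjointMap E h (lieCoord E G X)}

theorem _root_.HasDerivAt.mem_submodule [FiniteDimensional ℝ E] {f : ℝ → E} {f' : E} {t : ℝ}
    (S : Submodule ℝ E) (hf : HasDerivAt f f' t) (hS : ∀ᶠ s in nhds t, f s ∈ S) : f' ∈ S := by
  have h1 := hasDerivAt_iff_tendsto_slope.1 hf
  refine (Submodule.closed_of_finiteDimensional S).mem_of_tendsto h1 ?_
  filter_upwards [nhdsWithin_le_nhds hS] with s hs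
  exact S.smul_mem _ (S.sub_mem hs hS.self_of_nhds)

variable {V : ℕ → Submodule ℝ (GroupLieAlgebra 𝓘(ℝ, E) G)} {m : ℕ}
  {N : G → ℝ≥0∞}

theorem IsSmallAlong.list_prod_le {V₁ : Submodule ℝ (GroupLieAlgebra 𝓘(ℝ, E) G)}
    (hN : IsSmallAlong V₁ N) {l : List G} {C : ℝ≥0∞} (hl : ∀ h ∈ l, N h ≤ C) :
    N l.prod ≤ l.length * C := by
  induction l with
  | nil => simp [hN.one]
  | cons h l ih =>
    rw [List.prod_cons, List.length_cons]
    calc N (h * l.prod) ≤ N h + N l.prod := hN.mul_le _ _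
      _ ≤ C + l.length * C :=
        add_le_add (hl h (by simp)) (ih fun k hk => hl k (by simp [hk]))
      _ = ((l.length + 1 : ℕ) : ℝ≥0∞) * C := by push_cast; ring

variable [LieGroup 𝓘(ℝ, E) ∞ G]

/-- By induction on `k`: `⁅X, Y⁆` with `X ∈ V₁`, `Y ∈ V_{k+1}` is the derivative at `0` of
`Ad (x t) Y`, where `Ad (x t)` maps the span for `ε / 2` into the span for `ε` when `t` is small. -/
theorem IsStratification.map_le_adjointSpan [FiniteDimensional ℝ E] (hV : IsStratification V m)
    (hN : IsSmallAlong (V 1) N) (k : ℕ) (ε : ℝ≥0∞) (hε : 0 < ε) :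
    (V (k + 1)).map (lieCoord E G).toLinearMap ≤ adjointSpan (V 1) N ε := by
  induction k generalizing ε with
  | zero =>
    rintro _ ⟨X, hX, rfl⟩
    exact Submodule.subset_span ⟨1, by rwa [hN.one], X, hX, by simp [adjointMap_one]⟩
  | succ k ih =>
    rw [hV.bracket (k + 1) (by omega), Submodule.map_span, Submodule.span_le]
    rintro _ ⟨_, ⟨X, hX, Y, hY, rfl⟩, rfl⟩
    obtain ⟨x, hx, hNx⟩ := hN.tendsto X hX
    have hε2 : 0 < ε / 2 := ENNReal.half_pos hε.ne'
    refine HasDerivAt.mem_submodule _ (hasDerivAt_adjointMap (Y := Y) hx.zero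
      (hx.hasMFDerivAt 0)) ?_
    filter_upwards [hNx.eventually (gt_mem_nhds hε2)] with t ht
    have h1 : lieCoord E G Y ∈ adjointSpan (V 1) N (ε / 2) :=
      ih (ε / 2) hε2 ⟨Y, hY, rfl⟩
    have h2 : adjointSpan (V 1) N (ε / 2) ≤
        (adjointSpan (V 1) N ε).comap (adjointMap E (x t)).toLinearMap := by
      refine Submodule.span_le.2 ?_
      rintro _ ⟨h, hh, Z, hZ, rfl⟩
      refine Submodule.subset_span ⟨x t * h, ?_, Z, hZ, ?_⟩
      · calc N (x t * h) ≤ N (x t) + N h := hN.mul_le _ _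
          _ < ε / 2 + ε / 2 := ENNReal.add_lt_add ht hh
          _ = ε := ENNReal.add_halves ε
      · rw [adjointMap_mul]; rfl
    exact h2 h1

theorem IsStratification.adjointSpan_eq_top [FiniteDimensional ℝ E] (hV : IsStratification V m)
    (hN : IsSmallAlong (V 1) N) {ε : ℝ≥0∞} (hε : 0 < ε) : adjointSpan (V 1) N ε = ⊤ := by
  have h1 := hV.isInternal.submodule_iSup_eq_top
  rw [eq_top_iff, ← LinearEquiv.range (lieCoord E G), LinearMap.range_eq_map, ← h1,
    Submodule.map_iSup]
  refine iSup_le fun k => ?_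
  cases k with
  | zero =>
    have : V 0 = ⊥ := by
      by_contra h
      have := (hV.ne_bot_iff 0).1 h
      omega
    rw [this, Submodule.map_bot]
    exact bot_le
  | succ k => exact hV.map_le_adjointSpan hN k ε hε

theorem hasDerivAt_chart_conj {X : GroupLieAlgebra 𝓘(ℝ, E) G} {x : ℝ → G}
    (hx : IsOneParameterSubgroup X x) (h : G) :
    HasDerivAt (fun t => extChartAt 𝓘(ℝ, E) (1 : G) (h * x t * h⁻¹))
      (adjointMap E h (lieCoord E G X)) 0 := by
  have hs : x 0 ∈ (extChartAt 𝓘(ℝ, E) (1 : G)).source := by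
    rw [hx.zero]; exact mem_of_mem_nhds source_mem_nhds
  have h8 := hasDerivAt_chart_comp (hx.hasMFDerivAt 0) hs
  have he : idPt E G = extChartAt 𝓘(ℝ, E) (1 : G) (x 0) := by rw [hx.zero]; rfl
  have hc := hasFDerivAt_conj (E := E) h
  rw [he] at hc
  have h9 := hc.comp_hasDerivAt (0 : ℝ) h8
  rw [← he, leftFrame_idPt] at h9
  refine h9.congr_of_eventuallyEq ?_
  have h10 : ∀ᶠ t in nhds 0, x t ∈ (extChartAt 𝓘(ℝ, E) (1 : G)).source := by
    refine (hx.hasMFDerivAt 0).1.tendsto.eventually ?_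
    rw [hx.zero]; exact source_mem_nhds
  filter_upwards [h10] with t ht
  simp only [Function.comp_apply, PartialEquiv.left_inv _ ht]

theorem contMDiff_list_prod_map {ι : Type*} [Fintype ι] (k : ι → ℝ → G)
    (hk : ∀ i, ContMDiff 𝓘(ℝ, ℝ) 𝓘(ℝ, E) 1 (k i)) (l : List ι) :
    ContMDiff 𝓘(ℝ, ι → ℝ) 𝓘(ℝ, E) 1 (fun t : ι → ℝ => (l.map fun i => k i (t i)).prod) := by
  have : ContMDiffMul 𝓘(ℝ, E) 1 G := ContMDiffMul.of_le (n := ∞) (by norm_cast)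
  induction l with
  | nil => simpa using contMDiff_const
  | cons i l ih =>
    simp only [List.map_cons, List.prod_cons]
    refine ContMDiff.mul ?_ ih
    exact (hk i).comp (contDiff_apply ℝ ℝ i).contMDiff

/-- Products of curves through the identity whose velocities form a basis cover a neighbourhood of
the identity, by the open mapping theorem for strictly differentiable maps. -/
theorem map_nhds_prod_eq [FiniteDimensional ℝ E] {n : ℕ} (k : Fin n → ℝ → G)
    (hk : ∀ i, ContMDiff 𝓘(ℝ, ℝ) 𝓘(ℝ, E) 1 (k i)) (hk0 : ∀ i, k i 0 = 1)
    (b : Module.Basis (Fin n) ℝ E)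
    (hb : ∀ i, HasDerivAt (fun t => extChartAt 𝓘(ℝ, E) (1 : G) (k i t)) (b i) 0) :
    Filter.map (fun t : Fin n → ℝ => ((List.finRange n).map fun i => k i (t i)).prod) (nhds 0) =
      nhds 1 := by
  set φ := extChartAt 𝓘(ℝ, E) (1 : G)
  set P : (Fin n → ℝ) → G := fun t => ((List.finRange n).map fun i => k i (t i)).prod with hP
  have hP0 : P 0 = 1 := by
    simp only [hP, Pi.zero_apply, hk0]
    simp
  have hPs : ContMDiff 𝓘(ℝ, Fin n → ℝ) 𝓘(ℝ, E) 1 P := contMDiff_list_prod_map k hk _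
  have hF : ContDiffAt ℝ 1 (fun t => φ (P t)) 0 := by
    rw [← contMDiffAt_iff_contDiffAt]
    refine ContMDiffAt.comp (g := φ) 0 ((contMDiffAt_chart ?_).of_le (by norm_cast)) (hPs 0)
    rw [hP0]
    exact mem_of_mem_nhds source_mem_nhds
  have hF1 := hF.hasStrictFDerivAt (by simp)
  have hsurj : (fderiv ℝ (fun t => φ (P t)) 0).range = ⊤ := by
    rw [eq_top_iff, ← b.span_eq, Submodule.span_le]
    rintro _ ⟨i, rfl⟩
    refine ⟨Pi.single i 1, ?_⟩
    have h1 : HasDerivAt (fun s : ℝ => (Pi.single i s : Fin n → ℝ)) (Pi.single i 1) 0 :=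
      hasDerivAt_pi.2 fun j => by
        by_cases hij : j = i
        · subst hij; simpa using hasDerivAt_id' (0 : ℝ)
        · simpa [hij] using hasDerivAt_const (0 : ℝ) (0 : ℝ)
    have h2 : HasFDerivAt (fun t => φ (P t)) (fderiv ℝ (fun t => φ (P t)) 0)
        (Pi.single i (0 : ℝ)) := by
      rw [Pi.single_zero]; exact hF1.hasFDerivAt
    refine (h2.comp_hasDerivAt (0 : ℝ) h1).unique ?_
    refine (hb i).congr_of_eventuallyEq (Filter.Eventually.of_forall fun s => ?_)
    simp only [Function.comp_apply, hP]
    rw [List.prod_map_eq_pow_single i]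
    · rw [List.count_eq_one_of_mem (List.nodup_finRange n) (List.mem_finRange i)]
      simp
    · intro j hj _
      rw [Pi.single_eq_of_ne hj, hk0]
  have hmap := hF1.map_nhds_eq_of_surj hsurj
  have hsymm : Filter.map φ.symm (nhds (φ 1)) = nhds (1 : G) := by
    have := map_extChartAt_symm_nhdsWithin_range (I := 𝓘(ℝ, E)) (1 : G)
    rwa [modelWithCornersSelf_coe, range_id, nhdsWithin_univ] at this
  have hev : ∀ᶠ t in nhds (0 : Fin n → ℝ), P t = φ.symm (φ (P t)) := by
    have h3 : ∀ᶠ t in nhds (0 : Fin n → ℝ), P t ∈ φ.source := by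
      refine (hPs 0).continuousAt.tendsto.eventually ?_
      rw [hP0]
      exact source_mem_nhds
    filter_upwards [h3] with t ht
    exact (φ.left_inv ht).symm
  rw [hP0] at hmap
  rw [Filter.map_congr hev, ← hsymm, ← hmap, Filter.map_map]
  rfl

/-- A form of Chow's theorem: smallness along the directions of `V₁` implies smallness near the
identity. -/
theorem IsStratification.tendsto_of_isSmallAlong [FiniteDimensional ℝ E]
    (hV : IsStratification V m) (hN : IsSmallAlong (V 1) N) :
    Filter.Tendsto N (nhds 1) (nhds 0) := by
  have : ContMDiffMul 𝓘(ℝ, E) 1 G := ContMDiffMul.of_le (n := ∞) (by norm_cast)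
  rw [ENNReal.tendsto_nhds_zero]
  intro η hη
  obtain ⟨ε, hε, hεη⟩ := ENNReal.exists_nnreal_pos_mul_lt
    (a := (Module.finrank ℝ E : ℝ≥0∞) * 3) (b := η)
    (ENNReal.mul_ne_top (by simp) (by simp)) hη.ne'
  have hε' : (0 : ℝ≥0∞) < ε := by exact_mod_cast hε
  have hspan := (hV.adjointSpan_eq_top hN hε').ge
  obtain ⟨b, hb⟩ : ∃ b : Module.Basis (Fin (Module.finrank ℝ E)) ℝ E, ∀ i,
      ∃ h : G, N h < ε ∧ ∃ X ∈ V 1, b i = adjointMap E h (lieCoord E G X) := by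
    let b₀ := Module.Basis.ofSpan hspan
    refine ⟨b₀.reindex (b₀.indexEquiv (Module.finBasis ℝ E)), fun i => ?_⟩
    rw [Module.Basis.reindex_apply]
    exact Module.Basis.ofSpan_subset hspan (mem_range_self _)
  choose h hh X hX hbX using hb
  choose x hx hNx using fun i => hN.tendsto (X i) (hX i)
  -- the curve `k i` has velocity `b i` at `0`, and `N (k i t) < 3 * ε` for small `t`
  let k : Fin (Module.finrank ℝ E) → ℝ → G := fun i t => h i * x i t * (h i)⁻¹
  have hmap := map_nhds_prod_eq k
    (fun i => ((contMDiff_conj (h i)).of_le (by norm_cast)).comp (hx i).contMDiff)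
    (fun i => by simp [k, (hx i).zero]) b
    (fun i => by rw [hbX]; exact hasDerivAt_chart_conj (hx i) (h i))
  rw [← hmap, Filter.eventually_map]
  have hsmall : ∀ i, ∀ᶠ t in nhds (0 : Fin (Module.finrank ℝ E) → ℝ), N (x i (t i)) < ε :=
    fun i => (hNx i).comp ((continuous_apply i).tendsto (0 : Fin (Module.finrank ℝ E) → ℝ))
      |>.eventually (gt_mem_nhds hε')
  filter_upwards [Filter.eventually_all.2 hsmall] with t ht
  refine (hN.list_prod_le (C := ε * 3) ?_).trans (le_of_eq_of_le ?_ hεη.le)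
  · intro p hp
    obtain ⟨i, -, rfl⟩ := List.mem_map.1 hp
    calc N (h i * x i (t i) * (h i)⁻¹) ≤ N (h i * x i (t i)) + N (h i)⁻¹ := hN.mul_le _ _
      _ ≤ N (h i) + N (x i (t i)) + N (h i) := by
        rw [hN.inv]; exact add_le_add_left (hN.mul_le _ _) _
      _ ≤ ε + ε + ε := add_le_add (add_le_add (hh i).le (ht i).le) (hh i).le
      _ = ε * 3 := by ring
  · rw [List.length_map, List.length_finRange]
    ring

end Chow

/-! ### Difference quotients in horizontal directions -/

open scoped Pointwise

section Differentiation

variable {W : Type*} [NormedAddCommGroup W] [NormedSpace ℝ W]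

theorem HasRadonNikodymProperty.ae_differentiableAt_real (hW : HasRadonNikodymProperty W)
    {u : ℝ → W} {C : ℝ≥0} (hu : LipschitzWith C u) : ∀ᵐ t, DifferentiableAt ℝ u t := by
  let e := (OrthonormalBasis.singleton (Fin 1) ℝ).repr
  have h1 := hW 1 (u ∘ e.symm) (C * 1) (hu.comp e.symm.lipschitz)
  filter_upwards [e.measurePreserving.quasiMeasurePreserving.ae h1] with t ht
  have h2 := DifferentiableAt.comp t ht e.differentiableAt
  exact h2.congr_of_eventuallyEq (Filter.Eventually.of_forall fun s =>
    congrArg u (e.symm_apply_apply s).symm)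

variable {G : Type*} [Group G] {f : G → W} {x y : ℝ → G} {C C' : ℝ≥0}

/-- The difference quotient with step `t` of `f` at `p` along the curve `t ↦ p * y t`. -/
noncomputable def diffQuot (f : G → W) (y : ℝ → G) (t : ℝ) (p : G) : W :=
  t⁻¹ • (f (p * y t) - f p)

theorem norm_diffQuot_le (hy0 : y 0 = 1) (hL : ∀ p, LipschitzWith C fun t => f (p * y t))
    (t : ℝ) (p : G) : ‖diffQuot f y t p‖ ≤ C := by
  have h1 := (hL p).norm_sub_le t 0
  simp only [hy0, mul_one, sub_zero] at h1
  rw [diffQuot, norm_smul, norm_inv]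
  calc ‖t‖⁻¹ * ‖f (p * y t) - f p‖ ≤ ‖t‖⁻¹ * (C * ‖t‖) := by gcongr
    _ = C * (‖t‖⁻¹ * ‖t‖) := by ring
    _ ≤ C * 1 := by gcongr; exact inv_mul_le_one
    _ = C := mul_one _

theorem tendsto_diffQuot (hy0 : y 0 = 1) {p : G}
    (hp : DifferentiableAt ℝ (fun t => f (p * y t)) 0) {t : ℕ → ℝ}
    (ht : Filter.Tendsto t Filter.atTop (nhdsWithin 0 (Ioi 0))) :
    Filter.Tendsto (fun n => diffQuot f y (t n) p) Filter.atTop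
      (nhds (deriv (fun t => f (p * y t)) 0)) := by
  have h1 := hasDerivAt_iff_tendsto_slope_zero.1 hp.hasDerivAt
  simp only [zero_add, hy0, mul_one] at h1
  exact h1.comp (ht.mono_right (nhdsWithin_mono _ fun s hs => ne_of_gt hs))

variable [TopologicalSpace G] [IsTopologicalGroup G]

theorem continuous_diffQuot (hf : Continuous f) (t : ℝ) : Continuous (diffQuot f y t) := by
  unfold diffQuot
  fun_prop

variable [MeasurableSpace G] [BorelSpace G] {μ : Measure G}

theorem setLIntegral_mul_right_le [μ.IsMulRightInvariant] {K K' : Set G} (hK : MeasurableSet K)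
    (hK' : MeasurableSet K') {h : G} (hh : ∀ p ∈ K, p * h ∈ K') (F : G → ℝ≥0∞) :
    ∫⁻ p in K, F (p * h) ∂μ ≤ ∫⁻ p in K', F p ∂μ := by
  rw [← lintegral_indicator hK, ← lintegral_indicator hK',
    ← lintegral_mul_right_eq_self (K'.indicator F) h]
  refine lintegral_mono fun p => ?_
  by_cases hp : p ∈ K
  · simp [hp, hh p hp]
  · simp [hp]

/-- Every curve `t ↦ f (p * y t)` is differentiable at almost every time. By Fubini's theorem there
is a time `t` such that for almost every `p` the curve is differentiable at `t`, and the right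
translation by `y t` moves this time to `0`. -/
theorem HasRadonNikodymProperty.ae_differentiableAt_mul_curve [CompleteSpace W]
    [μ.IsMulRightInvariant] [SFinite μ]
    (hW : HasRadonNikodymProperty W) (hf : Continuous f) (hy : Continuous y)
    (hadd : ∀ s t, y (s + t) = y s * y t)
    (hL : ∀ p, LipschitzWith C fun t => f (p * y t)) :
    ∀ᵐ p ∂μ, DifferentiableAt ℝ (fun t => f (p * y t)) 0 := by
  have hmeas : MeasurableSet {z : G × ℝ | DifferentiableAt ℝ (fun t => f (z.1 * y t)) z.2} :=
    measurableSet_of_differentiableAt_with_param ℝ (f := fun p t => f (p * y t))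
      (hf.comp (continuous_fst.mul (hy.comp continuous_snd)))
  have hae : ∀ᵐ t : ℝ, ∀ᵐ p ∂μ, DifferentiableAt ℝ (fun t => f (p * y t)) t :=
    (Measure.ae_ae_comm hmeas).1
      (Filter.Eventually.of_forall fun p => hW.ae_differentiableAt_real (hL p))
  obtain ⟨t, ht⟩ := hae.exists
  have hinv := (measurePreserving_mul_right μ (y t)⁻¹).quasiMeasurePreserving.ae ht
  filter_upwards [hinv] with p hp
  have h1 : DifferentiableAt ℝ (fun s => f (p * (y t)⁻¹ * y s)) (0 + t) := by rwa [zero_add]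
  have h2 := differentiableAt_comp_add_const.2 h1
  refine h2.congr_of_eventuallyEq (Filter.Eventually.of_forall fun s => ?_)
  simp only
  rw [add_comm s t, hadd, mul_assoc p, inv_mul_cancel_left]

variable [SecondCountableTopology G]

theorem tendsto_setLIntegral_diffQuot_sub_deriv [IsFiniteMeasureOnCompacts μ]
    (hf : Continuous f) (hy0 : y 0 = 1) (hL : ∀ p, LipschitzWith C fun t => f (p * y t))
    (hdiff : ∀ᵐ p ∂μ, DifferentiableAt ℝ (fun t => f (p * y t)) 0) {t : ℕ → ℝ}
    (ht : Filter.Tendsto t Filter.atTop (nhdsWithin 0 (Ioi 0))) {K : Set G} (hK : IsCompact K) :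
    Filter.Tendsto (fun n => ∫⁻ p in K,
      ‖diffQuot f y (t n) p - deriv (fun t => f (p * y t)) 0‖ₑ ∂μ) Filter.atTop (nhds 0) := by
  have : IsFiniteMeasure (μ.restrict K) := ⟨by simpa using hK.measure_lt_top⟩
  have h1 := tendsto_lintegral_norm_of_dominated_convergence (μ := μ.restrict K)
    (F := fun n => diffQuot f y (t n)) (f := fun p => deriv (fun t => f (p * y t)) 0)
    (bound := fun _ => C)
    (fun n => (continuous_diffQuot hf _).stronglyMeasurable.aestronglyMeasurable)
    (hasFiniteIntegral_const _)
    (fun n => Filter.Eventually.of_forall fun p => norm_diffQuot_le hy0 hL _ p)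
    ((ae_restrict_of_ae hdiff).mono fun p hp => tendsto_diffQuot hy0 hp ht)
  simpa only [ofReal_norm] using h1

/-- Difference quotients are asymptotically invariant, in `L¹` on compact sets, under right
translations by elements tending to `1`: up to a small error they may be replaced by a difference
quotient with a fixed step, which is continuous. -/
theorem tendsto_setLIntegral_diffQuot_mul_sub [T2Space G] [LocallyCompactSpace G]
    [IsFiniteMeasureOnCompacts μ] [μ.IsMulRightInvariant]
    (hf : Continuous f) (hy0 : y 0 = 1) (hL : ∀ p, LipschitzWith C fun t => f (p * y t))
    (hdiff : ∀ᵐ p ∂μ, DifferentiableAt ℝ (fun t => f (p * y t)) 0) {t : ℕ → ℝ}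
    (ht : Filter.Tendsto t Filter.atTop (nhdsWithin 0 (Ioi 0))) {K : Set G} (hK : IsCompact K)
    {h : ℕ → G} (hh : Filter.Tendsto h Filter.atTop (nhds 1)) :
    Filter.Tendsto (fun n => ∫⁻ p in K,
      ‖diffQuot f y (t n) (p * h n) - diffQuot f y (t n) p‖ₑ ∂μ) Filter.atTop (nhds 0) := by
  obtain ⟨U, hU, hU1⟩ := exists_compact_mem_nhds (1 : G)
  set K' := K * U with hK'
  have hK'c : IsCompact K' := hK.mul hU
  have hKK' : K ⊆ K' := fun p hp => ⟨p, hp, 1, mem_of_mem_nhds hU1, mul_one p⟩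
  have hfin : IsFiniteMeasure (μ.restrict K) := ⟨by simpa using hK.measure_lt_top⟩
  set D := diffQuot f y
  have hDc : ∀ s, Continuous (D s) := fun s => continuous_diffQuot hf s
  set g : G → W := fun p => deriv (fun t => f (p * y t)) 0
  set A : ℕ → ℝ≥0∞ := fun n => ∫⁻ p in K', ‖D (t n) p - g p‖ₑ ∂μ
  have hA0 : Filter.Tendsto A Filter.atTop (nhds 0) :=
    tendsto_setLIntegral_diffQuot_sub_deriv hf hy0 hL hdiff ht hK'c
  have hgm : AEStronglyMeasurable g μ :=
    aestronglyMeasurable_of_tendsto_ae _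
      (fun n => (hDc (t n)).stronglyMeasurable.aestronglyMeasurable)
      (hdiff.mono fun p hp => tendsto_diffQuot hy0 hp ht)
  -- for a fixed step size the increments tend to `0` by continuity
  have hB0 : ∀ m, Filter.Tendsto (fun n => ∫⁻ p in K, ‖D (t m) (p * h n) - D (t m) p‖ₑ ∂μ)
      Filter.atTop (nhds 0) := by
    intro m
    have h1 := tendsto_lintegral_norm_of_dominated_convergence (μ := μ.restrict K)
      (F := fun n p => D (t m) (p * h n)) (f := D (t m)) (bound := fun _ => C)
      (fun n => ((hDc _).comp (continuous_mul_const
        (h n))).stronglyMeasurable.aestronglyMeasurable)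
      (hasFiniteIntegral_const _)
      (fun n => Filter.Eventually.of_forall fun p => norm_diffQuot_le hy0 hL _ _)
      (Filter.Eventually.of_forall fun p => by
        have h2 : Filter.Tendsto (fun n => p * h n) Filter.atTop (nhds p) := by
          simpa using hh.const_mul p
        exact ((hDc (t m)).tendsto p).comp h2)
    simpa only [ofReal_norm] using h1
  have hle : ∀ m, ∀ᶠ n in Filter.atTop, ∫⁻ p in K, ‖D (t n) (p * h n) - D (t n) p‖ₑ ∂μ ≤
      2 * A n + 2 * A m + ∫⁻ p in K, ‖D (t m) (p * h n) - D (t m) p‖ₑ ∂μ := by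
    intro m
    filter_upwards [hh.eventually hU1] with n hn
    have hmem : ∀ p ∈ K, p * h n ∈ K' := fun p hp => mul_mem_mul hp hn
    have hq : Measure.QuasiMeasurePreserving (fun p => p * h n) μ μ :=
      (measurePreserving_mul_right μ (h n)).quasiMeasurePreserving
    have hm1 : ∀ k, AEMeasurable (fun p => ‖D (t k) p - g p‖ₑ) μ := fun k =>
      ((hDc (t k)).stronglyMeasurable.aestronglyMeasurable.sub hgm).enorm
    have hm2 : ∀ k, AEMeasurable (fun p => ‖D (t k) (p * h n) - g (p * h n)‖ₑ) μ := fun k =>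
      (hm1 k).comp_quasiMeasurePreserving hq
    have hI1 : ∀ k, ∫⁻ p in K, ‖D (t k) p - g p‖ₑ ∂μ ≤ A k := fun k =>
      lintegral_mono_set hKK'
    have hI2 : ∀ k, ∫⁻ p in K, ‖D (t k) (p * h n) - g (p * h n)‖ₑ ∂μ ≤ A k := fun k =>
      setLIntegral_mul_right_le hK.measurableSet hK'c.measurableSet hmem
        (fun p => ‖D (t k) p - g p‖ₑ)
    calc ∫⁻ p in K, ‖D (t n) (p * h n) - D (t n) p‖ₑ ∂μ
        ≤ ∫⁻ p in K, (‖D (t n) (p * h n) - g (p * h n)‖ₑ + ‖D (t m) (p * h n) - g (p * h n)‖ₑ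
            + ‖D (t m) p - g p‖ₑ + ‖D (t n) p - g p‖ₑ
            + ‖D (t m) (p * h n) - D (t m) p‖ₑ) ∂μ := by
          refine lintegral_mono fun p => ?_
          have : D (t n) (p * h n) - D (t n) p = (D (t n) (p * h n) - g (p * h n))
            - (D (t m) (p * h n) - g (p * h n)) + (D (t m) p - g p) - (D (t n) p - g p)
            + (D (t m) (p * h n) - D (t m) p) := by abel
          rw [this]
          refine (enorm_add_le _ _).trans (add_le_add_left ?_ _)
          refine enorm_sub_le.trans (add_le_add_left ?_ _)
          exact (enorm_add_le _ _).trans (add_le_add_left enorm_sub_le _)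
      _ = ∫⁻ p in K, ‖D (t n) (p * h n) - g (p * h n)‖ₑ ∂μ
            + ∫⁻ p in K, ‖D (t m) (p * h n) - g (p * h n)‖ₑ ∂μ
            + ∫⁻ p in K, ‖D (t m) p - g p‖ₑ ∂μ + ∫⁻ p in K, ‖D (t n) p - g p‖ₑ ∂μ
            + ∫⁻ p in K, ‖D (t m) (p * h n) - D (t m) p‖ₑ ∂μ := by
          rw [lintegral_add_left', lintegral_add_left', lintegral_add_left',
            lintegral_add_left']
          · exact (hm2 n).restrict
          · exact ((hm2 n).add (hm2 m)).restrict
          · exact (((hm2 n).add (hm2 m)).add (hm1 m)).restrict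
          · exact ((((hm2 n).add (hm2 m)).add (hm1 m)).add (hm1 n)).restrict
      _ ≤ A n + A m + A m + A n + ∫⁻ p in K, ‖D (t m) (p * h n) - D (t m) p‖ₑ ∂μ := by
          gcongr
          exacts [hI2 n, hI2 m, hI1 m, hI1 n]
      _ = 2 * A n + 2 * A m + ∫⁻ p in K, ‖D (t m) (p * h n) - D (t m) p‖ₑ ∂μ := by ring
  rw [ENNReal.tendsto_nhds_zero]
  intro ε hε
  have h2A : Filter.Tendsto (fun n => 2 * A n) Filter.atTop (nhds 0) := by
    simpa using ENNReal.Tendsto.const_mul hA0 (Or.inr (by simp : (2 : ℝ≥0∞) ≠ ⊤))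
  obtain ⟨m, hm⟩ := (h2A.eventually (gt_mem_nhds hε)).exists
  have hlim : Filter.Tendsto (fun n => 2 * A n + 2 * A m +
      ∫⁻ p in K, ‖D (t m) (p * h n) - D (t m) p‖ₑ ∂μ) Filter.atTop (nhds (2 * A m)) := by
    simpa using (h2A.add_const (2 * A m)).add (hB0 m)
  filter_upwards [hle m, hlim.eventually (gt_mem_nhds hm)] with n hn1 hn2
  exact hn1.trans hn2.le

/-- The function `f` does not see commutators to first order: the increments over `y t` of the
difference quotients along `x`, and those over `x t` of the difference quotients along `y`, tend to
`0`, and they differ by the quotient in the statement. -/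
theorem tendsto_setLIntegral_commutator [T2Space G] [LocallyCompactSpace G] [CompleteSpace W]
    [IsFiniteMeasureOnCompacts μ] [μ.IsMulRightInvariant] [SFinite μ]
    (hW : HasRadonNikodymProperty W) (hf : Continuous f)
    (hx : Continuous x) (hx0 : x 0 = 1) (hxadd : ∀ s t, x (s + t) = x s * x t)
    (hxL : ∀ p, LipschitzWith C fun t => f (p * x t))
    (hy : Continuous y) (hy0 : y 0 = 1) (hyadd : ∀ s t, y (s + t) = y s * y t)
    (hyL : ∀ p, LipschitzWith C' fun t => f (p * y t)) {t : ℕ → ℝ}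
    (ht : Filter.Tendsto t Filter.atTop (nhdsWithin 0 (Ioi 0))) {K : Set G} (hK : IsCompact K) :
    Filter.Tendsto (fun n => ∫⁻ p in K, ‖(t n)⁻¹ • (f (p * (y (t n) * x (t n))) -
      f (p * (x (t n) * y (t n))))‖ₑ ∂μ) Filter.atTop (nhds 0) := by
  have ht0 : Filter.Tendsto t Filter.atTop (nhds 0) := ht.mono_right nhdsWithin_le_nhds
  have hxt : Filter.Tendsto (fun n => x (t n)) Filter.atTop (nhds 1) := by
    rw [← hx0]; exact (hx.tendsto 0).comp ht0
  have hyt : Filter.Tendsto (fun n => y (t n)) Filter.atTop (nhds 1) := by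
    rw [← hy0]; exact (hy.tendsto 0).comp ht0
  have h1 := tendsto_setLIntegral_diffQuot_mul_sub (μ := μ) hf hy0 hyL
    (hW.ae_differentiableAt_mul_curve hf hy hyadd hyL) ht hK hxt
  have h2 := tendsto_setLIntegral_diffQuot_mul_sub (μ := μ) hf hx0 hxL
    (hW.ae_differentiableAt_mul_curve hf hx hxadd hxL) ht hK hyt
  have h3 := h2.add h1
  rw [add_zero] at h3
  refine tendsto_of_tendsto_of_tendsto_of_le_of_le tendsto_const_nhds h3
    (fun n => zero_le) fun n => ?_
  simp only
  rw [← lintegral_add_left]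
  · refine lintegral_mono fun p => ?_
    have : (t n)⁻¹ • (f (p * (y (t n) * x (t n))) - f (p * (x (t n) * y (t n)))) =
        (diffQuot f x (t n) (p * y (t n)) - diffQuot f x (t n) p) -
        (diffQuot f y (t n) (p * x (t n)) - diffQuot f y (t n) p) := by
      simp only [diffQuot, ← smul_sub, mul_assoc]
      congr 1
      abel
    rw [this]
    exact enorm_sub_le
  · exact (((continuous_diffQuot hf _).comp (continuous_mul_const _)).sub
      (continuous_diffQuot hf _)).enorm.measurable

end Differentiation

/-! ### Maps which are Lipschitz for the Carnot–Carathéodory distance -/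

section Increment

/-- The largest distance between values of `f` at `p` and at the right translate `p * h`. -/
noncomputable def increment {G W : Type*} [Group G] [PseudoEMetricSpace W] (f : G → W) (h : G) :
    ℝ≥0∞ :=
  ⨆ p, edist (f (p * h)) (f p)

variable {G W : Type*} [Group G] [PseudoEMetricSpace W] (f : G → W)

theorem increment_one : increment f 1 = 0 := by simp [increment]

theorem increment_mul_le (h k : G) : increment f (h * k) ≤ increment f h + increment f k := by
  refine iSup_le fun p => (edist_triangle _ (f (p * h)) _).trans ?_
  rw [← mul_assoc, add_comm (increment f h)]
  exact add_le_add (le_iSup (fun q => edist (f (q * k)) (f q)) (p * h))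
    (le_iSup (fun q => edist (f (q * h)) (f q)) p)

theorem increment_inv_le (h : G) : increment f h⁻¹ ≤ increment f h := by
  refine iSup_le fun p => ?_
  rw [edist_comm]
  exact le_of_eq_of_le (by simp) (le_iSup (fun q => edist (f (q * h)) (f q)) (p * h⁻¹))

theorem increment_inv (h : G) : increment f h⁻¹ = increment f h :=
  (increment_inv_le f h).antisymm (by simpa using increment_inv_le f h⁻¹)

variable {f} in
theorem continuous_of_tendsto_increment [TopologicalSpace G] [IsTopologicalGroup G]
    (hf : Filter.Tendsto (increment f) (nhds 1) (nhds 0)) : Continuous f := by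
  rw [continuous_iff_continuousAt]
  intro p
  rw [ContinuousAt, ← map_mul_left_nhds_one p, Filter.tendsto_map'_iff,
    tendsto_iff_edist_tendsto_0]
  exact tendsto_of_tendsto_of_tendsto_of_le_of_le tendsto_const_nhds hf (fun _ => zero_le)
    fun h => le_iSup (fun q => edist (f (q * h)) (f q)) p

end Increment

section Stratification

variable {E : Type*} [NormedAddCommGroup E] [NormedSpace ℝ E]
  {G : Type*} [TopologicalSpace G] [ChartedSpace E G] [Group G]
  {V : ℕ → Submodule ℝ (GroupLieAlgebra 𝓘(ℝ, E) G)} {m : ℕ}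

/-- Otherwise `V₂ = [V₁, V₁]` would be contained in `V₁`, hence trivial. -/
theorem IsStratification.exists_bracket_notMem (hV : IsStratification V m) (hm : 2 ≤ m) :
    ∃ X ∈ V 1, ∃ Y ∈ V 1, ⁅X, Y⁆ ∉ V 1 := by
  by_contra! h
  refine (hV.ne_bot_iff 2).2 ⟨by omega, hm⟩ ?_
  have hdisj : Disjoint (V 1) (V 2) :=
    hV.isInternal.submodule_iSupIndep.pairwiseDisjoint (by norm_num)
  have h2 : V 2 ≤ V 1 := by
    rw [hV.bracket 1 le_rfl, Submodule.span_le]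
    rintro _ ⟨X, hX, Y, hY, rfl⟩
    exact h X hX Y hY
  exact le_bot_iff.1 (hdisj h2 le_rfl)

variable [LieGroup 𝓘(ℝ, E) ∞ G] {g : InnerProductSpace.Core ℝ (V 1)}
  {W : Type*} [PseudoEMetricSpace W] {f : G → W} {L : ℝ≥0}

theorem lipschitzWith_mul_oneParameterSubgroup
    (hf : ∀ p q, edist (f p) (f q) ≤ L * ccEDist g p q) (X : V 1) {x : ℝ → G}
    (hx : IsOneParameterSubgroup (X : GroupLieAlgebra 𝓘(ℝ, E) G) x) (p : G) :
    LipschitzWith (L * (√(g.inner X X)).toNNReal) fun t => f (p * x t) := by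
  have key : ∀ a b : ℝ, a ≤ b → edist (f (p * x a)) (f (p * x b)) ≤
      (L * (√(g.inner X X)).toNNReal : ℝ≥0) * edist a b := by
    intro a b hab
    refine (hf _ _).trans ?_
    rw [ENNReal.coe_mul, mul_assoc, edist_comm a b, edist_dist, Real.dist_eq,
      abs_of_nonneg (sub_nonneg.2 hab)]
    gcongr
    exact ccEDist_mul_oneParam_le g X hx p hab
  intro a b
  rcases le_total a b with hab | hab
  · exact key a b hab
  · rw [edist_comm, edist_comm a b]
    exact key b a hab

theorem isSmallAlong_increment [CompleteSpace E] [T2Space G]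
    (hf : ∀ p q, edist (f p) (f q) ≤ L * ccEDist g p q) :
    IsSmallAlong (V 1) (increment f) where
  one := increment_one f
  mul_le := increment_mul_le f
  inv := increment_inv f
  tendsto X hX := by
    obtain ⟨x, hx⟩ := exists_isOneParameterSubgroup X
    refine ⟨x, hx, ?_⟩
    have hlim : Filter.Tendsto
        (fun t : ℝ => ((L * (√(g.inner ⟨X, hX⟩ ⟨X, hX⟩)).toNNReal : ℝ≥0) : ℝ≥0∞) * edist t 0)
        (nhds 0) (nhds 0) := by
      have h1 : Filter.Tendsto (fun t : ℝ => edist t 0) (nhds 0) (nhds 0) :=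
        tendsto_iff_edist_tendsto_0.1 Filter.tendsto_id
      simpa only [mul_zero] using ENNReal.Tendsto.const_mul h1 (Or.inr ENNReal.coe_ne_top)
    refine tendsto_of_tendsto_of_tendsto_of_le_of_le tendsto_const_nhds hlim
      (fun _ => zero_le) fun t => iSup_le fun p => ?_
    have h2 := lipschitzWith_mul_oneParameterSubgroup hf ⟨X, hX⟩ hx p t 0
    simpa [hx.zero] using h2

end Stratification

/-- Near `1` the quotient in `tendsto_setLIntegral_commutator` is bounded below by
`exists_le_ccEDist_commutator`, so its integral cannot tend to `0`. -/
theorem not_exists_isBiLipschitz_ccEDist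
    {E : Type*} [NormedAddCommGroup E] [NormedSpace ℝ E] [FiniteDimensional ℝ E]
    {G : Type*} [TopologicalSpace G] [ChartedSpace E G] [Group G] [LieGroup 𝓘(ℝ, E) ∞ G]
    [T2Space G] [SecondCountableTopology G]
    (V : ℕ → Submodule ℝ (GroupLieAlgebra 𝓘(ℝ, E) G)) (m : ℕ)
    (hV : IsStratification V m) (hm : 2 ≤ m)
    (g : InnerProductSpace.Core ℝ (V 1))
    {W : Type*} [NormedAddCommGroup W] [NormedSpace ℝ W] [CompleteSpace W]
    (hW : HasRadonNikodymProperty W) :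
    ¬ ∃ f : G → W, IsBiLipschitz (ccEDist g) f := by
  rintro ⟨f, L, hL1, hL⟩
  have hL0 : (L : ℝ≥0∞) ≠ 0 := by
    have : L ≠ 0 := (zero_lt_one.trans_le hL1).ne'
    exact_mod_cast this
  have : CompleteSpace E := FiniteDimensional.complete ℝ E
  have : IsTopologicalGroup G := topologicalGroup_of_lieGroup 𝓘(ℝ, E) ∞
  have : LocallyCompactSpace G := Manifold.locallyCompact_of_finiteDimensional 𝓘(ℝ, E)
  have hup : ∀ p q, edist (f p) (f q) ≤ L * ccEDist g p q := fun p q => (hL p q).2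
  have hf : Continuous f := continuous_of_tendsto_increment
    (hV.tendsto_of_isSmallAlong (isSmallAlong_increment hup))
  obtain ⟨X, hX, Y, hY, hXY⟩ := hV.exists_bracket_notMem hm
  obtain ⟨x, hx⟩ := exists_isOneParameterSubgroup X
  obtain ⟨y, hy⟩ := exists_isOneParameterSubgroup Y
  obtain ⟨c, hc, s₀, hs₀, U, hU, hlow⟩ := exists_le_ccEDist_commutator g hXY hx.zero hy.zero
    (hx.hasMFDerivAt 0) (hy.hasMFDerivAt 0) hx.contMDiff hy.contMDiff
  obtain ⟨K, hK1, hKU, hK⟩ := local_compact_nhds hU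
  borelize G
  let K₀ : TopologicalSpace.PositiveCompacts G :=
    ⟨⟨K, hK⟩, ⟨1, mem_interior_iff_mem_nhds.2 hK1⟩⟩
  -- the inverse of a left Haar measure is right-invariant
  let μ : Measure G := (Measure.haarMeasure K₀).inv
  let t : ℕ → ℝ := fun n => 1 / ((n : ℝ) + 1)
  have ht : Filter.Tendsto t Filter.atTop (nhdsWithin 0 (Ioi 0)) :=
    tendsto_nhdsWithin_iff.2 ⟨tendsto_one_div_add_atTop_nhds_zero_nat,
      Filter.Eventually.of_forall fun n => mem_Ioi.2 (by positivity)⟩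
  have hlim := tendsto_setLIntegral_commutator (μ := μ) hW hf
    hx.contMDiff.continuous hx.zero hx.add
    (lipschitzWith_mul_oneParameterSubgroup hup ⟨X, hX⟩ hx)
    hy.contMDiff.continuous hy.zero hy.add
    (lipschitzWith_mul_oneParameterSubgroup hup ⟨Y, hY⟩ hy) ht hK
  have hpos : 0 < (L : ℝ≥0∞)⁻¹ * ENNReal.ofReal c * μ K := by
    have h1 : 0 < μ K := Measure.measure_pos_of_mem_nhds μ hK1
    have h2 : (0 : ℝ≥0∞) < (L : ℝ≥0∞)⁻¹ := ENNReal.inv_pos.2 ENNReal.coe_ne_top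
    exact ENNReal.mul_pos (ENNReal.mul_pos h2.ne' (ENNReal.ofReal_pos.2 hc).ne').ne' h1.ne'
  have hev : ∀ᶠ n in Filter.atTop, t n ∈ Ioo 0 s₀ :=
    ht.eventually (Ioo_mem_nhdsGT hs₀)
  obtain ⟨n, hn1, hn2⟩ := ((hlim.eventually (gt_mem_nhds hpos)).and hev).exists
  refine hn1.not_ge ?_
  rw [← setLIntegral_const]
  refine setLIntegral_mono' hK.measurableSet fun p hp => ?_
  have hle : (L : ℝ≥0∞)⁻¹ * ENNReal.ofReal (c * t n) ≤
      edist (f (p * (y (t n) * x (t n)))) (f (p * (x (t n) * y (t n)))) :=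
    (mul_le_mul_right (hlow p (hKU hp) (t n) hn2.1 hn2.2) _).trans (hL _ _).1
  rw [enorm_smul, ← edist_eq_enorm_sub]
  refine le_trans ?_ (mul_le_mul_right hle _)
  rw [enorm_inv hn2.1.ne', Real.enorm_of_nonneg hn2.1.le, ENNReal.ofReal_mul hc.le]
  calc (L : ℝ≥0∞)⁻¹ * ENNReal.ofReal c
      = (ENNReal.ofReal (t n))⁻¹ * ENNReal.ofReal (t n) * ((L : ℝ≥0∞)⁻¹ * ENNReal.ofReal c) := by
        rw [ENNReal.inv_mul_cancel (ENNReal.ofReal_pos.2 hn2.1).ne' ENNReal.ofReal_ne_top, one_mul]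
    _ ≤ _ := le_of_eq (by ring)

end Carnot

theorem theorem3p5
    {E : Type*} [NormedAddCommGroup E] [NormedSpace ℝ E] [FiniteDimensional ℝ E]
    {G : Type*} [TopologicalSpace G] [ChartedSpace E G] [Group G] [LieGroup 𝓘(ℝ, E) ∞ G]
    [T2Space G] [SecondCountableTopology G] [SimplyConnectedSpace G]
    (V : ℕ → Submodule ℝ (GroupLieAlgebra 𝓘(ℝ, E) G)) (m : ℕ)
    (hV : Carnot.IsStratification V m) (hm : 2 ≤ m)
    (g : InnerProductSpace.Core ℝ (V 1))
    {W : Type*} [NormedAddCommGroup W] [NormedSpace ℝ W] [CompleteSpace W]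
    (hW : Carnot.HasRadonNikodymProperty W) :
    ¬ ∃ f : G → W, Carnot.IsBiLipschitz (Carnot.ccEDist g) f := by
  exact Carnot.not_exists_isBiLipschitz_ccEDist V m hV hm g hW
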